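/- \textbf{Setting.} Let $k\ge 0$ be an integer. Let $\mathcal P_{2k+1}$ be the unique polynomial of degree at most $2k+1$ with $\mathcal P_{2k+1}^{(\alpha)}(0)=(-1)^\alpha$ and $\mathcal P_{2k+1}^{(\alpha)}(-1)=e^{-1}$ for $0\le\alpha\le k$ (Hermite interpolation), and put $$g(p)=e^{-p}\ (p>0),\qquad g(p)=\mathcal P_{2k+1}(p)\ (-1\le p\le 0),\qquad g(p)=e^{p}\ (p<-1).$$ Let $s\ge 1$ be real, $T>0$, and let $u(t,x)$ be a complex-valued solution of $\partial_t u=\partial_{xx}u$ on $(0,T)\times\mathbb R$, $2\pi$-periodic in $x$ and continuous on $[0,T]\times\mathbb R$, with $\partial_{xx}u$ continuous on $(0,T)\times\mathbb R$; write $u_0=u(0,\cdot)$, $u_T=u(T,\cdot)$, $\Omega_x=[-\pi,\pi]$, $\hat f(l)=\frac1{2\pi}\int_{-\pi}^{\pi}f(x)e^{-ilx}\,dx$ and $\|f\|_{H^s(\Omega_x)}^2=2\pi\sum_{l\in\mathbb Z}(1+l^2)^s|\hat f(l)|^2$. Assume $\|u_0\|_{H^s(\Omega_x)}<\infty$. (The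 problem is to recover $u_0$ from $u_T$.) \textbf{Scheme.} Let $L>0$, let $N,M$ be positive even integers, $\Delta p=2\pi L/N$, $\Delta x=2\pi/M$, $p_j=-\pi L+j\Delta p$, $x_j=-\pi+j\Delta x$, $\mu^p_j=(j-N/2)/L$, $\mu_j=j-M/2$, and $\phi^p_j(p)=e^{i\mu^p_j(p+\pi L)}$ $(0\le j<N)$, $\phi_j(x)=e^{i\mu_j(x+\pi)}$ $(0\le j<M)$. Put $\Phi_p=(\phi^p_j(p_i))_{ij}$, $\Phi=(\phi_j(x_i))_{ij}$, $\Phi_{px}=\Phi_p\otimes\Phi$, $D_p=\mathrm{diag}(\mu^p_j)$, $D_x=\mathrm{diag}(\mu_j)$, $A=D_x^2$. Let $\boldsymbol w_h(t)$, $t\in[0,T]$, solve $$\frac{d}{dt}\boldsymbol w_h=i\,\Phi_{px}(D_p\otimes A)\Phi_{px}^{-1}\boldsymbol w_h,\qquad \boldsymbol w_h(T)=\big(g(p_i)\,u_T(x_j)\big)_{i,j},$$ and put $$w_h^d(x,p)=\sum_{i<N,\;j<M}\big(\Phi_{px}^{-1}\boldsymbol w_h(0)\big)_{ij}\,\phi^p_i(p)\,\phi_j(x),\qquad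 u_h^d(x,p)=e^{p}\,w_h^d(x,p).$$ \textbf{Claim.} $g\in C^k(\mathbb R)$. Moreover, for all $k$, $s$, $T$, $\eta_{\max}>0$ and $K>0$ there is a constant $C>0$, depending only on these (in particular not on the mesh sizes), such that the following holds for all $L,N,M,u,\boldsymbol w_h$ as above, all $\varepsilon>0$ and all $\mathcal M>0$. If \begin{itemize} \item $\eta_{\max}\ge(\delta/\varepsilon)^{1/s}$, where $\delta^2=2\pi\sum_{|l|>\eta_{\max}}(1+l^2)^s|\hat u_0(l)|^2$, \item $e^{-(\pi L-4.5\,\eta_{\max}^2T)}\|u_T\|_{L^2(\Omega_x)}\le K\varepsilon$, \item $\mathcal M\le\min\{\pi L-\eta_{\max}^2T,\ \tfrac12\eta_{\max}^2T\}$, \end{itemize} then with $\tilde\Omega_p=(\eta_{\max}^2T,\ \eta_{\max}^2T+\mathcal M)$ $$\|u_0-u_h^d\|_{L^2(\tilde\Omega_p)\times L^2(\Omega_x)}\le C\Big[\big(\Delta p^{\,k+1}+\Delta x^{\,s}\big)\|u_0\|_{H^s(\Omega_x)}+\varepsilon\Big].$$ -/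

import Mathlib

open Real Polynomial
open scoped Kronecker Matrix

namespace SmoothInit

/-! ### The smooth initial profile -/

/-- `P` is the two-point Hermite interpolation polynomial of degree at most `2 * k + 1` which matches
the derivatives of orders `0, …, k` of `exp (-p)` at `p = 0` and of `exp p` at `p = -1`. -/
structure IsHermiteInterpolant (k : ℕ) (P : ℝ[X]) : Prop where
  natDegree_le : P.natDegree ≤ 2 * k + 1
  at_zero : ∀ α ≤ k, (derivative^[α] P).eval 0 = (-1) ^ α
  at_neg_one : ∀ α ≤ k, (derivative^[α] P).eval (-1) = rexp (-1)

/-- A polynomial of degree at most `2 * k + 1` whose derivatives of orders `0, …, k` vanish at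
`0` and at `-1` is zero. -/
theorem eq_zero_of_hermite_zero (k : ℕ) (P : ℝ[X]) (hdeg : P.natDegree ≤ 2 * k + 1)
    (h0 : ∀ α ≤ k, (derivative^[α] P).eval 0 = 0)
    (h1 : ∀ α ≤ k, (derivative^[α] P).eval (-1) = 0) : P = 0 := by
  by_contra hP
  have r0 : k < P.rootMultiplicity 0 :=
    lt_rootMultiplicity_of_isRoot_iterate_derivative hP h0
  have r1 : k < P.rootMultiplicity (-1) :=
    lt_rootMultiplicity_of_isRoot_iterate_derivative hP h1
  have hle : P.roots.count 0 + P.roots.count (-1) ≤ Multiset.card P.roots := by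
    have h := Multiset.toFinset_sum_count_eq P.roots
    have m0 : (0 : ℝ) ∈ P.roots.toFinset := by
      rw [Multiset.mem_toFinset, ← Multiset.count_pos, count_roots]; omega
    have m1 : (-1 : ℝ) ∈ P.roots.toFinset := by
      rw [Multiset.mem_toFinset, ← Multiset.count_pos, count_roots]; omega
    rw [← h, ← Finset.sum_pair (f := fun a => P.roots.count a)
      (show (0 : ℝ) ≠ -1 by norm_num)]
    refine Finset.sum_le_sum_of_subset ?_
    intro a ha
    rcases Finset.mem_insert.1 ha with rfl | ha
    · exact m0
    · rw [Finset.mem_singleton.1 ha]; exact m1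
  have hc := P.card_roots'
  rw [count_roots, count_roots] at hle
  omega

theorem existsUnique_hermiteInterpolant (k : ℕ) : ∃! P : ℝ[X], IsHermiteInterpolant k P := by
  let D : ℝ → (degreeLT ℝ (2 * k + 2) →ₗ[ℝ] (Fin (k + 1) → ℝ)) := fun t =>
    LinearMap.pi fun α =>
      (leval t) ∘ₗ ((derivative : ℝ[X] →ₗ[ℝ] ℝ[X]) ^ (α : ℕ)) ∘ₗ (degreeLT ℝ (2 * k + 2)).subtype
  have hD : ∀ t (P : degreeLT ℝ (2 * k + 2)) α, D t P α = (derivative^[(α : ℕ)] P.1).eval t := by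
    intro t P α
    simp [D, Module.End.pow_apply, leval]
  have hdeg : ∀ P : ℝ[X], P ∈ degreeLT ℝ (2 * k + 2) ↔ P.natDegree ≤ 2 * k + 1 := by
    intro P
    rw [mem_degreeLT]
    constructor
    · intro h
      by_cases hP : P = 0
      · simp [hP]
      · have := (natDegree_lt_iff_degree_lt hP).2 h
        omega
    · intro h
      refine lt_of_le_of_lt degree_le_natDegree ?_
      exact_mod_cast Nat.lt_succ_of_le h
  let F : degreeLT ℝ (2 * k + 2) →ₗ[ℝ] (Fin (k + 1) → ℝ) × (Fin (k + 1) → ℝ) :=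
    (D 0).prod (D (-1))
  have hinj : Function.Injective F := by
    rw [← LinearMap.ker_eq_bot, LinearMap.ker_eq_bot']
    intro P hP
    have h0 : D 0 P = 0 := congrArg Prod.fst hP
    have h1 : D (-1) P = 0 := congrArg Prod.snd hP
    apply Subtype.ext
    refine eq_zero_of_hermite_zero k P.1 ((hdeg _).1 P.2) ?_ ?_
    · intro α hα
      rw [← hD 0 P ⟨α, by omega⟩, h0]; rfl
    · intro α hα
      rw [← hD (-1) P ⟨α, by omega⟩, h1]; rfl
  have : Module.Finite ℝ (degreeLT ℝ (2 * k + 2)) :=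
    Module.Finite.equiv (degreeLTEquiv ℝ (2 * k + 2)).symm
  have hrank : Module.finrank ℝ (degreeLT ℝ (2 * k + 2))
      = Module.finrank ℝ ((Fin (k + 1) → ℝ) × (Fin (k + 1) → ℝ)) := by
    rw [(degreeLTEquiv ℝ (2 * k + 2)).finrank_eq]
    simp
    ring
  have hsurj := (LinearMap.injective_iff_surjective_of_finrank_eq_finrank hrank).1 hinj
  obtain ⟨P, hP⟩ := hsurj (fun α => (-1) ^ (α : ℕ), fun _ => rexp (-1))
  have e0 : D 0 P = fun α : Fin (k + 1) => (-1 : ℝ) ^ (α : ℕ) := congrArg Prod.fst hP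
  have e1 : D (-1) P = fun _ : Fin (k + 1) => rexp (-1) := congrArg Prod.snd hP
  have hPk : IsHermiteInterpolant k P.1 := by
    refine ⟨(hdeg _).1 P.2, ?_, ?_⟩
    · intro α hα
      rw [← hD 0 P ⟨α, by omega⟩, e0]
    · intro α hα
      rw [← hD (-1) P ⟨α, by omega⟩, e1]
  refine ⟨P.1, hPk, ?_⟩
  intro Q hQ
  rw [← sub_eq_zero]
  refine eq_zero_of_hermite_zero k _ ?_ ?_ ?_
  · exact (natDegree_sub_le _ _).trans (max_le hQ.natDegree_le hPk.natDegree_le)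
  · intro α hα
    rw [iterate_derivative_sub, eval_sub, hQ.at_zero α hα, hPk.at_zero α hα, sub_self]
  · intro α hα
    rw [iterate_derivative_sub, eval_sub, hQ.at_neg_one α hα, hPk.at_neg_one α hα, sub_self]

/-- The Hermite interpolation polynomial `P_{2k+1}`. -/
noncomputable def hermitePoly (k : ℕ) : ℝ[X] := (existsUnique_hermiteInterpolant k).choose

theorem hermitePoly_spec (k : ℕ) : IsHermiteInterpolant k (hermitePoly k) :=
  (existsUnique_hermiteInterpolant k).choose_spec.1

/-- The smooth initial profile: `exp (-p)` for `p > 0`, the Hermite polynomial on `[-1, 0]`,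
and `exp p` for `p < -1`. -/
noncomputable def smoothProfile (k : ℕ) (p : ℝ) : ℝ :=
  if 0 < p then rexp (-p) else if -1 ≤ p then (hermitePoly k).eval p else rexp p

/-! ### Norms of `2π`-periodic functions on `Ω_x = [-π, π]` -/

/-- Fourier coefficient `(2π)⁻¹ ∫_{-π}^{π} f(x) exp(-i l x) dx`. -/
noncomputable def coeff (f : ℝ → ℂ) (l : ℤ) : ℂ :=
  fourierCoeffOn (neg_lt_self Real.pi_pos) f l

/-- The norm of `L²(-π, π)`. -/
noncomputable def l2Norm (f : ℝ → ℂ) : ℝ := √(∫ x in (-π)..π, ‖f x‖ ^ 2)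

/-- A (continuous, periodic) function belongs to `H^s(Ω_x)`. -/
def MemSobolev (s : ℝ) (f : ℝ → ℂ) : Prop :=
  Summable fun l : ℤ => (1 + (l : ℝ) ^ 2) ^ s * ‖coeff f l‖ ^ 2

/-- The norm of `H^s(Ω_x)`, normalised so that `H^0` carries the norm of `L²(-π, π)`. -/
noncomputable def sobolevNorm (s : ℝ) (f : ℝ → ℂ) : ℝ :=
  √(2 * π * ∑' l : ℤ, (1 + (l : ℝ) ^ 2) ^ s * ‖coeff f l‖ ^ 2)

/-- The part `δ(η_max)` of the `H^s` norm that is carried by the frequencies `|l| > η_max`. -/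
noncomputable def sobolevTail (s ηmax : ℝ) (f : ℝ → ℂ) : ℝ :=
  √(2 * π * ∑' l : {l : ℤ // ηmax < |(l : ℝ)|},
    (1 + ((l : ℤ) : ℝ) ^ 2) ^ s * ‖coeff f l‖ ^ 2)

/-! ### The backward heat equation -/

/-- `u` is a classical `2π`-periodic solution of `∂ₜ u = ∂ₓₓ u` on `(0, T)`, continuous on
`[0, T]`. The data of the backward problem is `u T`, the function to be recovered is `u 0`. -/
structure IsHeatSolution (T : ℝ) (u : ℝ → ℝ → ℂ) : Prop where
  continuousOn : ContinuousOn (fun q : ℝ × ℝ => u q.1 q.2) (Set.Icc 0 T ×ˢ Set.univ)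
  periodic : ∀ t ∈ Set.Icc 0 T, Function.Periodic (u t) (2 * π)
  contDiff : ∀ t ∈ Set.Ioo 0 T, ContDiff ℝ 2 (u t)
  continuousOn_deriv_two :
    ContinuousOn (fun q : ℝ × ℝ => iteratedDeriv 2 (u q.1) q.2) (Set.Ioo 0 T ×ˢ Set.univ)
  heat_eq : ∀ t ∈ Set.Ioo 0 T, ∀ x : ℝ,
    HasDerivAt (fun τ => u τ x) (iteratedDeriv 2 (u t) x) t

/-! ### The Fourier spectral discretisation -/

/-- Grid points `x_j = -π + j Δx` with `Δx = 2π / M`. -/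
noncomputable def xGrid (M : ℕ) (j : Fin M) : ℝ := -π + j * (2 * π / M)

/-- Frequencies `μ_j = j - M / 2`. -/
noncomputable def xFreq (M : ℕ) (j : Fin M) : ℝ := (j : ℝ) - M / 2

/-- Grid points `p_j = -π L + j Δp` with `Δp = 2π L / N`. -/
noncomputable def pGrid (L : ℝ) (N : ℕ) (j : Fin N) : ℝ := -(π * L) + j * (2 * π * L / N)

/-- Frequencies `μ^p_j = (j - N / 2) / L`. -/
noncomputable def pFreq (L : ℝ) (N : ℕ) (j : Fin N) : ℝ := ((j : ℝ) - N / 2) / L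

/-- Basis functions `φ_j(x) = exp(i μ_j (x + π))`. -/
noncomputable def xBasis (M : ℕ) (j : Fin M) (x : ℝ) : ℂ :=
  Complex.exp (Complex.I * (xFreq M j * (x + π) : ℝ))

/-- Basis functions `φ^p_j(p) = exp(i μ^p_j (p + π L))`. -/
noncomputable def pBasis (L : ℝ) (N : ℕ) (j : Fin N) (p : ℝ) : ℂ :=
  Complex.exp (Complex.I * (pFreq L N j * (p + π * L) : ℝ))

/-- `Φ = (φ_j(x_i))_{ij}`. -/
noncomputable def xMatrix (M : ℕ) : Matrix (Fin M) (Fin M) ℂ :=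
  Matrix.of fun i j => xBasis M j (xGrid M i)

/-- `Φ_p = (φ^p_j(p_i))_{ij}`. -/
noncomputable def pMatrix (L : ℝ) (N : ℕ) : Matrix (Fin N) (Fin N) ℂ :=
  Matrix.of fun i j => pBasis L N j (pGrid L N i)

/-- `Φ_{px} = Φ_p ⊗ Φ`. -/
noncomputable def pxMatrix (L : ℝ) (N M : ℕ) : Matrix (Fin N × Fin M) (Fin N × Fin M) ℂ :=
  pMatrix L N ⊗ₖ xMatrix M

/-- `D_p = diag(μ^p_0, …, μ^p_{N-1})`. -/
noncomputable def pDiag (L : ℝ) (N : ℕ) : Matrix (Fin N) (Fin N) ℂ :=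
  Matrix.diagonal fun j => (pFreq L N j : ℂ)

/-- `D_x = diag(μ_0, …, μ_{M-1})`. -/
noncomputable def xDiag (M : ℕ) : Matrix (Fin M) (Fin M) ℂ :=
  Matrix.diagonal fun j => (xFreq M j : ℂ)

/-- `w` solves the discretised Schrödingerised system
`w' = i Φ_{px} (D_p ⊗ D_x²) Φ_{px}⁻¹ w` on `[0, T]` with the terminal value
`w(T) = g_h ⊗ u_h(T)`, where `g_h` and `u_h(T)` are the nodal values of `g` and of `uT`. -/
structure IsDiscreteSolution (g : ℝ → ℝ) (T L : ℝ) (N M : ℕ) (uT : ℝ → ℂ)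
    (w : ℝ → Fin N × Fin M → ℂ) : Prop where
  ode : ∀ t ∈ Set.Icc 0 T, HasDerivWithinAt w
    ((Complex.I • (pxMatrix L N M * (pDiag L N ⊗ₖ (xDiag M ^ 2)) * (pxMatrix L N M)⁻¹)) *ᵥ w t)
    (Set.Icc 0 T) t
  terminal : w T = fun q => (g (pGrid L N q.1) : ℂ) * uT (xGrid M q.2)

/-- The trigonometric polynomial in `(x, p)` with the nodal values `v`. -/
noncomputable def trigInterp (L : ℝ) (N M : ℕ) (v : Fin N × Fin M → ℂ) (x p : ℝ) : ℂ :=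
  ∑ q : Fin N × Fin M, ((pxMatrix L N M)⁻¹ *ᵥ v) q * (pBasis L N q.1 p * xBasis M q.2 x)

/-- The recovered function `u_h^d(0, x, p) = e^p w_h^d(0, x, p)`. -/
noncomputable def recovered (L : ℝ) (N M : ℕ) (w : ℝ → Fin N × Fin M → ℂ) (x p : ℝ) : ℂ :=
  (rexp p : ℂ) * trigInterp L N M (w 0) x p

/-- The error `‖u_0 - u_h^d‖` in `L²((a, a + m)) × L²(-π, π)`. -/
noncomputable def recoveryError (u0 : ℝ → ℂ) (uh : ℝ → ℝ → ℂ) (a m : ℝ) : ℝ :=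
  √(∫ p in a..(a + m), ∫ x in (-π)..π, ‖u0 x - uh x p‖ ^ 2)

end SmoothInit

/-! The matrices of the scheme are diagonalised by discrete Fourier modes, and a multiplier `exp(-i
μ^p μ_j² T)` in the `p`-modes is a translation. Hence the discrete solution at time 0 is `∑ j, c_j
exp(i μ_j (x + π)) G(p - μ_j² T)`, where `c_j` are the discrete Fourier coefficients of `u_T` and
`G` is the trigonometric interpolant of the profile `g` (`IsDiscreteSolution.trigInterp_initial`).
If `c_j` and `G` were exact, then multiplication by `e^p` would return the coefficient of `u_0`
wherever `p ≥ μ_j² T`, because `g` is `e^{-p}` there and the heat flow multiplies the coefficient by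
`e^{-μ_j² T}`. On the recovery window this covers every frequency `|μ_j| ≤ η_max`.

The error then has four sources (`recovered_error_le`). (a) Truncating the Fourier series of `u_0`
costs `Δx^s` times its `H^s` norm. (b) Aliasing in `c_j` is summable over all modes with the same
rate, since the heat flow supplies the factors `e^{-l² T}` (`IsHeatSolution.sum_norm_sub_le`). (c)
Frequencies above `η_max` are not recovered; their coefficients are summed by Cauchy–Schwarz, which
uses `s ≥ 1`, and are controlled by `δ ≤ ε η_max^s` (`sum_high_le`). (d) For low frequencies, `G -
g` is of size `Δp^{k+1} + e^{-πL}`. The first part is paid by the norm of `u_0`, the second by the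
hypothesis on `u_T`.

The heart of (d) is that the constant does not depend on `L`. The Fourier transform of `g` decays
like `|ξ|^{-(k+2)}`, because the Hermite conditions cancel all boundary terms in `k + 1`
integrations by parts. Cutting `g` off at `±πL` adds only `e^{-πL} / (1 + ξ²)`, because `g` takes
equal values at the two ends. The normalisation `1/L` of the coefficients compensates for the
density `L` of the frequencies `n/L` (`exists_interp_profile_sup_bounds`).

The factor `e^p` is bounded on the window by a constant depending on `η_max` and `T`, so all errors
are multiplied by a fixed amount. -/

namespace SmoothInit

/-! ### Discrete Fourier transform and aliasing -/

/-- The integer frequency `j - N / 2`. -/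
def nodeFreq (N : ℕ) (j : Fin N) : ℤ := (j : ℤ) - (N : ℤ) / 2

theorem nodeFreq_injective (N : ℕ) : Function.Injective (nodeFreq N) := by
  intro i j h
  simp only [nodeFreq] at h
  exact Fin.ext (by omega)

theorem cast_nodeFreq {N : ℕ} (hN : Even N) (j : Fin N) :
    ((nodeFreq N j : ℤ) : ℝ) = (j : ℝ) - N / 2 := by
  obtain ⟨n, rfl⟩ := hN
  have : ((n + n : ℕ) : ℤ) / 2 = n := by push_cast; omega
  rw [nodeFreq, this]
  push_cast
  ring

theorem pFreq_eq {N : ℕ} (hN : Even N) (L : ℝ) (j : Fin N) :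
    pFreq L N j = (nodeFreq N j : ℝ) / L := by
  rw [pFreq, cast_nodeFreq hN]

/-- The representative of `n` modulo `N` among the frequencies `j - N / 2`. -/
def aliasIdx (N : ℕ) (hN : 0 < N) (n : ℤ) : Fin N :=
  ⟨((n + (N : ℤ) / 2) % N).toNat, by
    have h0 := Int.emod_nonneg (n + (N : ℤ) / 2) (b := N) (by omega)
    have h1 := Int.emod_lt_of_pos (n + (N : ℤ) / 2) (b := N) (by omega)
    omega⟩

theorem nodeFreq_aliasIdx (N : ℕ) (hN : 0 < N) (n : ℤ) :
    nodeFreq N (aliasIdx N hN n) = n - N * ((n + (N : ℤ) / 2) / N) := by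
  have h0 := Int.emod_nonneg (n + (N : ℤ) / 2) (b := N) (by omega)
  have h := Int.emod_add_mul_ediv (n + (N : ℤ) / 2) N
  simp only [nodeFreq, aliasIdx]
  rw [Int.toNat_of_nonneg h0]
  linarith

/-- The inequality is strict because the nodes run from `-N/2` to `N/2 - 1`: the frequency `N/2`
aliases to `-N/2`. -/
theorem nodeFreq_aliasIdx_of_lt {N : ℕ} (hN : 0 < N) (he : Even N) {n : ℤ}
    (h : 2 * |n| < N) : nodeFreq N (aliasIdx N hN n) = n := by
  obtain ⟨m, rfl⟩ := he
  have h1 := abs_lt.1 (show |n| < m by push_cast at h; omega)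
  rw [nodeFreq_aliasIdx, Int.ediv_eq_zero_of_lt] <;> push_cast <;> omega

theorem aliasIdx_nodeFreq {N : ℕ} (hN : 0 < N) (j : Fin N) :
    aliasIdx N hN (nodeFreq N j) = j := by
  have hj : ((j : ℕ) : ℤ) < N := by exact_mod_cast j.2
  apply Fin.ext
  simp only [aliasIdx, nodeFreq, sub_add_cancel]
  rw [Int.emod_eq_of_lt (by positivity) hj, Int.toNat_natCast]

/-- The exponential `exp(i n (p + π L) / L)`. -/
noncomputable def wave (L : ℝ) (n : ℤ) (p : ℝ) : ℂ :=
  Complex.exp (Complex.I * ((n : ℝ) / L * (p + π * L) : ℝ))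

theorem norm_wave (L : ℝ) (n : ℤ) (p : ℝ) : ‖wave L n p‖ = 1 := by
  rw [wave, mul_comm, Complex.norm_exp_ofReal_mul_I]

theorem pBasis_eq {N : ℕ} (hN : Even N) (L : ℝ) (j : Fin N) (p : ℝ) :
    pBasis L N j p = wave L (nodeFreq N j) p := by
  rw [pBasis, wave, pFreq_eq hN]

theorem xBasis_eq {N : ℕ} (hN : Even N) (j : Fin N) (p : ℝ) :
    xBasis N j p = wave 1 (nodeFreq N j) p := by
  rw [xBasis, wave, xFreq, cast_nodeFreq hN]
  simp

theorem xGrid_eq (M : ℕ) (j : Fin M) : xGrid M j = pGrid 1 M j := by simp [xGrid, pGrid]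

theorem xMatrix_eq (M : ℕ) : xMatrix M = pMatrix 1 M := by
  ext i j
  simp [xMatrix, pMatrix, xBasis, pBasis, xFreq, pFreq, xGrid_eq]

theorem wave_pGrid_congr {L : ℝ} (hL : L ≠ 0) {N : ℕ} (hN : 0 < N) {n n' q : ℤ}
    (h : n' = n - N * q) (i : Fin N) : wave L n' (pGrid L N i) = wave L n (pGrid L N i) := by
  subst h
  have hN' : (N : ℝ) ≠ 0 := by positivity
  rw [wave, wave, Complex.exp_eq_exp_iff_exists_int]
  refine ⟨-(q * i), ?_⟩
  have : (((n - N * q : ℤ) : ℝ) / L * (pGrid L N i + π * L))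
      = (n : ℝ) / L * (pGrid L N i + π * L) + (-(q * i)) * (2 * π) := by
    rw [pGrid]
    push_cast
    field_simp
    ring
  rw [this]
  push_cast
  ring

theorem pMatrix_apply {N : ℕ} (hN : Even N) (L : ℝ) (i j : Fin N) :
    pMatrix L N i j = wave L (nodeFreq N j) (pGrid L N i) := by
  rw [pMatrix, Matrix.of_apply, pBasis_eq hN]

theorem wave_pGrid_aliasIdx {L : ℝ} (hL : L ≠ 0) {N : ℕ} (hN : 0 < N) (he : Even N) (n : ℤ)
    (i : Fin N) : wave L n (pGrid L N i) = pMatrix L N i (aliasIdx N hN n) := by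
  rw [pMatrix_apply he, wave_pGrid_congr hL hN (nodeFreq_aliasIdx N hN n)]

/-- Each entry is a geometric sum over the powers of an `N`-th root of unity. Off the diagonal the
root is not 1, since two node indices differ by less than `N`. -/
theorem conjTranspose_mul_pMatrix {L : ℝ} (hL : L ≠ 0) {N : ℕ} (hN : 0 < N) (he : Even N) :
    (pMatrix L N)ᴴ * pMatrix L N = (N : ℂ) • (1 : Matrix (Fin N) (Fin N) ℂ) := by
  have hN' : (N : ℝ) ≠ 0 := by positivity
  have hNc : (N : ℂ) ≠ 0 := by exact_mod_cast hN.ne'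
  ext j k
  have hterm : ∀ i : Fin N, star (pMatrix L N i j) * pMatrix L N i k =
      (Complex.exp (2 * π * Complex.I * ((k : ℂ) - j) / N)) ^ (i : ℕ) := by
    intro i
    rw [pMatrix_apply he, pMatrix_apply he, wave, wave, ← Complex.exp_nat_mul,
      Complex.star_def, ← Complex.exp_conj, ← Complex.exp_add]
    congr 1
    simp only [map_mul, Complex.conj_I, Complex.conj_ofReal]
    have h1 := cast_nodeFreq he j
    have h2 := cast_nodeFreq he k
    have e : ∀ n : ℝ, n / L * (pGrid L N i + π * L) = n * (i * (2 * π) / N) := by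
      intro n
      rw [pGrid]
      field_simp
      ring
    rw [e, e, h1, h2]
    push_cast
    field_simp
    ring
  rw [Matrix.mul_apply]
  simp only [Matrix.conjTranspose_apply, hterm]
  rw [Fin.sum_univ_eq_sum_range (fun i => Complex.exp (2 * π * Complex.I * ((k : ℂ) - j) / N) ^ i)]
  by_cases hjk : j = k
  · subst hjk
    simp
  · have hz1 : Complex.exp (2 * π * Complex.I * ((k : ℂ) - j) / N) ≠ 1 := by
      intro h
      rw [Complex.exp_eq_one_iff] at h
      obtain ⟨n, hn⟩ := h
      have h2 : (2 * π * Complex.I : ℂ) ≠ 0 := by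
        simp [Real.pi_ne_zero]
      have h3 : ((k : ℂ) - j) = n * N := by
        field_simp at hn
        have := mul_left_cancel₀ h2 (show 2 * π * Complex.I * ((k : ℂ) - j)
          = 2 * π * Complex.I * (n * N) by linear_combination (2 * π * Complex.I) * hn)
        exact this
      have h4 : ((k : ℕ) : ℤ) - (j : ℕ) = n * N := by exact_mod_cast h3
      have hk : ((k : ℕ) : ℤ) < N := by exact_mod_cast k.2
      have hj : ((j : ℕ) : ℤ) < N := by exact_mod_cast j.2
      have hd : (N : ℤ) ∣ ((k : ℕ) : ℤ) - (j : ℕ) := ⟨n, by rw [h4]; ring⟩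
      have h5 : ((k : ℕ) : ℤ) - (j : ℕ) = 0 := by
        apply Int.eq_zero_of_abs_lt_dvd hd
        rw [abs_lt]
        constructor <;> omega
      exact hjk (Fin.ext (by omega))
    rw [geom_sum_eq hz1, ← Complex.exp_nat_mul]
    have : Complex.exp ((N : ℂ) * (2 * π * Complex.I * ((k : ℂ) - j) / N)) = 1 := by
      rw [Complex.exp_eq_one_iff]
      refine ⟨(k : ℤ) - j, ?_⟩
      push_cast
      field_simp
    rw [this]
    simp [hjk]

theorem inv_pMatrix {L : ℝ} (hL : L ≠ 0) {N : ℕ} (hN : 0 < N) (he : Even N) :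
    (pMatrix L N)⁻¹ = (N : ℂ)⁻¹ • (pMatrix L N)ᴴ := by
  have hNc : (N : ℂ) ≠ 0 := by exact_mod_cast hN.ne'
  apply Matrix.inv_eq_left_inv
  rw [Matrix.smul_mul, conjTranspose_mul_pMatrix hL hN he, smul_smul, inv_mul_cancel₀ hNc, one_smul]

theorem inv_mul_pMatrix {L : ℝ} (hL : L ≠ 0) {N : ℕ} (hN : 0 < N) (he : Even N) :
    (pMatrix L N)⁻¹ * pMatrix L N = 1 := by
  have hNc : (N : ℂ) ≠ 0 := by exact_mod_cast hN.ne'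
  rw [inv_pMatrix hL hN he, Matrix.smul_mul, conjTranspose_mul_pMatrix hL hN he, smul_smul,
    inv_mul_cancel₀ hNc, one_smul]

/-- Discrete Parseval identity. -/
theorem sum_norm_sq_inv_pMatrix_mulVec {L : ℝ} (hL : L ≠ 0) {N : ℕ} (hN : 0 < N) (he : Even N)
    (v : Fin N → ℂ) :
    ∑ j, ‖((pMatrix L N)⁻¹ *ᵥ v) j‖ ^ 2 = (N : ℝ)⁻¹ * ∑ j, ‖v j‖ ^ 2 := by
  have hNc : (N : ℂ) ≠ 0 := by exact_mod_cast hN.ne'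
  have hinv := inv_mul_pMatrix hL hN he
  have hinv' : pMatrix L N * (pMatrix L N)⁻¹ = 1 := mul_eq_one_comm.1 hinv
  set c := (pMatrix L N)⁻¹ *ᵥ v with hc
  have hv : v = pMatrix L N *ᵥ c := by
    rw [hc, Matrix.mulVec_mulVec, hinv', Matrix.one_mulVec]
  have key : ∀ a : Fin N → ℂ, (star a) ⬝ᵥ a = ((∑ j, ‖a j‖ ^ 2 : ℝ) : ℂ) := by
    intro a
    rw [dotProduct]
    push_cast
    refine Finset.sum_congr rfl fun j _ => ?_
    rw [Pi.star_apply, Complex.star_def, Complex.conj_mul']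
  have h1 : star v ⬝ᵥ v = N * (star c ⬝ᵥ c) := by
    rw [hv, Matrix.star_mulVec, ← Matrix.dotProduct_mulVec, Matrix.mulVec_mulVec,
      conjTranspose_mul_pMatrix hL hN he, Matrix.smul_mulVec, Matrix.one_mulVec, dotProduct_smul,
      smul_eq_mul]
  rw [key, key] at h1
  have h2 : ∑ j, ‖v j‖ ^ 2 = N * ∑ j, ‖c j‖ ^ 2 := by exact_mod_cast h1
  have hN' : (N : ℝ) ≠ 0 := by positivity
  rw [h2]
  field_simp

/-- Aliasing: the coefficients of the interpolant differ from the Fourier coefficients by at most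
the `ℓ¹` tail. -/
theorem sum_norm_sub_le_tail {L : ℝ} (hL : L ≠ 0) {N : ℕ} (hN : 0 < N) (he : Even N) {c : ℤ → ℂ}
    (hc : Summable fun n => ‖c n‖) {v : Fin N → ℂ}
    (hv : ∀ i, HasSum (fun n => c n * wave L n (pGrid L N i)) (v i)) :
    ∑ j, ‖((pMatrix L N)⁻¹ *ᵥ v) j - c (nodeFreq N j)‖ ≤
      ∑' n : ℤ, {n : ℤ | (N : ℤ) ≤ 2 * |n|}.indicator (fun n => ‖c n‖) n := by
  have hinv := inv_mul_pMatrix hL hN he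
  -- On the grid a wave equals the node wave it aliases to, so the discrete coefficient collects all
  -- `c n` with `n` in the residue class of node `j`.
  have hcoef : ∀ j, HasSum (fun n => c n * (if j = aliasIdx N hN n then (1 : ℂ) else 0))
      (((pMatrix L N)⁻¹ *ᵥ v) j) := by
    intro j
    have h := hasSum_sum (s := Finset.univ)
      (fun i _ => (hv i).mul_left ((pMatrix L N)⁻¹ j i))
    rw [Matrix.mulVec, dotProduct]
    refine (funext fun n => ?_ : (fun n => c n * (if j = aliasIdx N hN n then (1 : ℂ) else 0)) =
      fun n => ∑ i, (pMatrix L N)⁻¹ j i * (c n * wave L n (pGrid L N i))) ▸ h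
    have : (1 : Matrix (Fin N) (Fin N) ℂ) j (aliasIdx N hN n) =
      ∑ i, (pMatrix L N)⁻¹ j i * pMatrix L N i (aliasIdx N hN n) := by
      rw [← hinv, Matrix.mul_apply]
    rw [Matrix.one_apply] at this
    rw [this, Finset.mul_sum]
    refine Finset.sum_congr rfl fun i _ => ?_
    rw [wave_pGrid_aliasIdx hL hN he n i]
    ring
  have hsingle : ∀ j, HasSum (fun n => c n * (if n = nodeFreq N j then (1 : ℂ) else 0))
      (c (nodeFreq N j)) := by
    intro j
    convert hasSum_ite_eq (nodeFreq N j) (c (nodeFreq N j)) using 2 with n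
    split_ifs with h <;> simp [h]
  let b : Fin N → ℤ → ℝ := fun j n =>
    if j = aliasIdx N hN n ∧ n ≠ nodeFreq N j then ‖c n‖ else 0
  have hb : ∀ j, Summable (b j) := fun j =>
    Summable.of_nonneg_of_le (fun n => by simp only [b]; split_ifs <;> positivity)
      (fun n => by simp only [b]; split_ifs <;> simp) hc
  have h1 : ∀ j, ‖((pMatrix L N)⁻¹ *ᵥ v) j - c (nodeFreq N j)‖ ≤ ∑' n, b j n := by
    intro j
    have h := (hcoef j).sub (hsingle j)
    rw [← h.tsum_eq]
    refine tsum_of_norm_bounded (hb j).hasSum fun n => ?_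
    simp only [b]
    by_cases h2 : n = nodeFreq N j
    · subst h2
      simp [aliasIdx_nodeFreq]
    · by_cases h3 : j = aliasIdx N hN n
      · rw [if_pos h3, if_neg h2, if_pos ⟨h3, h2⟩]
        simp
      · rw [if_neg h3, if_neg h2, if_neg fun h => h3 h.1]
        simp
  refine (Finset.sum_le_sum fun j _ => h1 j).trans ?_
  rw [← Summable.tsum_finsetSum fun j _ => hb j]
  refine Summable.tsum_le_tsum ?_ (summable_sum fun j _ => hb j) (hc.indicator _)
  intro n
  -- Each `n` aliases to exactly one node, so the sum over `j` counts it at most once, and not at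
  -- all if it is itself a node frequency.
  have h2 : ∑ j, b j n = if n ≠ nodeFreq N (aliasIdx N hN n) then ‖c n‖ else 0 := by
    rw [Finset.sum_eq_single (aliasIdx N hN n)]
    · simp [b]
    · intro j _ hj
      simp [b, hj]
    · simp
  rw [h2]
  by_cases h3 : (N : ℤ) ≤ 2 * |n|
  · rw [Set.indicator_of_mem (by exact h3)]
    split_ifs <;> simp
  · rw [if_neg]
    · exact Set.indicator_nonneg (fun _ _ => norm_nonneg _) _
    · rw [not_not, nodeFreq_aliasIdx_of_lt hN he (not_le.1 h3)]

/-! ### Sup-norm bounds for trigonometric interpolants -/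

/-- The trigonometric polynomial with nodal values `v`. -/
noncomputable def interp (L : ℝ) (N : ℕ) (v : Fin N → ℂ) (p : ℝ) : ℂ :=
  ∑ j, ((pMatrix L N)⁻¹ *ᵥ v) j * pBasis L N j p

theorem continuous_wave (L : ℝ) (n : ℤ) : Continuous (wave L n) := by
  unfold wave
  fun_prop

theorem continuous_pBasis (L : ℝ) (N : ℕ) (j : Fin N) : Continuous (pBasis L N j) := by
  unfold pBasis
  fun_prop

theorem continuous_interp (L : ℝ) (N : ℕ) (v : Fin N → ℂ) : Continuous (interp L N v) := by
  unfold interp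
  have := continuous_pBasis L N
  fun_prop

theorem norm_pBasis (L : ℝ) (N : ℕ) (j : Fin N) (p : ℝ) : ‖pBasis L N j p‖ = 1 := by
  rw [pBasis, mul_comm, Complex.norm_exp_ofReal_mul_I]

theorem norm_interp_le {L : ℝ} (hL : L ≠ 0) {N : ℕ} (hN : 0 < N) (he : Even N) {c : ℤ → ℂ}
    (hc : Summable fun n => ‖c n‖) {v : Fin N → ℂ}
    (hv : ∀ i, HasSum (fun n => c n * wave L n (pGrid L N i)) (v i)) (p : ℝ) :
    ‖interp L N v p‖ ≤ 2 * ∑' n, ‖c n‖ := by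
  have h1 := sum_norm_sub_le_tail hL hN he hc hv
  have h2 : ∑' n : ℤ, {n : ℤ | (N : ℤ) ≤ 2 * |n|}.indicator (fun n => ‖c n‖) n ≤ ∑' n, ‖c n‖ :=
    (hc.indicator _).tsum_le_tsum (fun n => Set.indicator_le_self' (fun _ _ => norm_nonneg _) n) hc
  have h3 : ∑ j, ‖c (nodeFreq N j)‖ ≤ ∑' n, ‖c n‖ := by
    rw [← tsum_fintype (L := .unconditional _)]
    exact tsum_comp_le_tsum_of_inj hc (fun _ => norm_nonneg _) (nodeFreq_injective N)
  calc ‖interp L N v p‖ ≤ ∑ j, ‖((pMatrix L N)⁻¹ *ᵥ v) j‖ := by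
        refine (norm_sum_le _ _).trans (Finset.sum_le_sum fun j _ => ?_)
        rw [norm_mul, norm_pBasis, mul_one]
    _ ≤ ∑ j, (‖((pMatrix L N)⁻¹ *ᵥ v) j - c (nodeFreq N j)‖ + ‖c (nodeFreq N j)‖) :=
        Finset.sum_le_sum fun j _ => by
          have := norm_add_le (((pMatrix L N)⁻¹ *ᵥ v) j - c (nodeFreq N j)) (c (nodeFreq N j))
          rwa [sub_add_cancel] at this
    _ ≤ 2 * ∑' n, ‖c n‖ := by rw [Finset.sum_add_distrib]; linarith

/-- The factor 2 counts the tail twice: once for the aliased coefficients, once for the frequencies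
missing from the truncated series. -/
theorem norm_interp_sub_le {L : ℝ} (hL : L ≠ 0) {N : ℕ} (hN : 0 < N) (he : Even N) {c : ℤ → ℂ}
    (hc : Summable fun n => ‖c n‖) {v : Fin N → ℂ}
    (hv : ∀ i, HasSum (fun n => c n * wave L n (pGrid L N i)) (v i)) {p : ℝ} {y : ℂ}
    (hy : HasSum (fun n => c n * wave L n p) y) :
    ‖interp L N v p - y‖ ≤
      2 * ∑' n : ℤ, {n : ℤ | (N : ℤ) ≤ 2 * |n|}.indicator (fun n => ‖c n‖) n := by
  have h1 := sum_norm_sub_le_tail hL hN he hc hv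
  let d : ℤ → ℂ := fun n => if n ∈ Finset.univ.image (nodeFreq N) then c n * wave L n p else 0
  have hd : HasSum d (∑ j, c (nodeFreq N j) * pBasis L N j p) := by
    have h : HasSum d _ := hasSum_sum_of_ne_finset_zero (f := d) (s := Finset.univ.image (nodeFreq N))
      (fun n hn => by simp only [d, if_neg hn])
    rw [Finset.sum_image fun _ _ _ _ h => nodeFreq_injective N h] at h
    convert h using 2 with j
    simp only [d]
    rw [if_pos (Finset.mem_image_of_mem _ (Finset.mem_univ j)), pBasis_eq he]
  have h2 : ‖y - ∑ j, c (nodeFreq N j) * pBasis L N j p‖ ≤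
      ∑' n : ℤ, {n : ℤ | (N : ℤ) ≤ 2 * |n|}.indicator (fun n => ‖c n‖) n := by
    have h := hy.sub hd
    rw [← h.tsum_eq]
    refine tsum_of_norm_bounded (hc.indicator _).hasSum fun n => ?_
    simp only [d]
    split_ifs with hn
    · rw [sub_self, norm_zero]
      exact Set.indicator_nonneg (fun _ _ => norm_nonneg _) _
    · rw [Set.indicator_of_mem, sub_zero, norm_mul, norm_wave, mul_one]
      by_contra hlt
      apply hn
      have := nodeFreq_aliasIdx_of_lt hN he (n := n) (not_le.1 hlt)
      rw [← this]
      exact Finset.mem_image_of_mem _ (Finset.mem_univ _)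
  calc ‖interp L N v p - y‖
      = ‖∑ j, (((pMatrix L N)⁻¹ *ᵥ v) j - c (nodeFreq N j)) * pBasis L N j p
          - (y - ∑ j, c (nodeFreq N j) * pBasis L N j p)‖ := by
        rw [interp]
        simp only [sub_mul, Finset.sum_sub_distrib]
        congr 1
        ring
    _ ≤ _ := by
        refine (norm_sub_le _ _).trans ?_
        have h3 : ‖∑ j, (((pMatrix L N)⁻¹ *ᵥ v) j - c (nodeFreq N j)) * pBasis L N j p‖ ≤
            ∑ j, ‖((pMatrix L N)⁻¹ *ᵥ v) j - c (nodeFreq N j)‖ := by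
          refine (norm_sum_le _ _).trans (Finset.sum_le_sum fun j _ => ?_)
          rw [norm_mul, norm_pBasis, mul_one]
        linarith

/-! ### Regularity of the smooth profile -/

theorem hasDerivAt_glue {f g f' g' : ℝ → ℝ} {a : ℝ} (hf : ∀ x, HasDerivAt f (f' x) x)
    (hg : ∀ x, HasDerivAt g (g' x) x) (h : f a = g a) (h' : f' a = g' a) (x : ℝ) :
    HasDerivAt (fun p => if a < p then f p else g p) (if a < x then f' x else g' x) x := by
  rcases lt_trichotomy a x with hx | rfl | hx
  · rw [if_pos hx]
    refine (hf x).congr_of_eventuallyEq ?_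
    filter_upwards [lt_mem_nhds hx] with p hp
    rw [if_pos hp]
  · rw [if_neg (lt_irrefl a), ← hasDerivWithinAt_univ, ← Set.Iic_union_Ici (a := a)]
    refine HasDerivWithinAt.union ?_ ?_
    · refine (hg a).hasDerivWithinAt.congr (fun p hp => ?_) ?_
      · rw [if_neg (not_lt.2 hp)]
      · rw [if_neg (lt_irrefl a)]
    · rw [← h']
      refine (hf a).hasDerivWithinAt.congr (fun p hp => ?_) ?_
      · rcases eq_or_lt_of_le (Set.mem_Ici.1 hp) with rfl | hp
        · rw [if_neg (lt_irrefl a), h]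
        · rw [if_pos hp]
      · rw [if_neg (lt_irrefl a), h]
  · rw [if_neg (not_lt.2 hx.le)]
    refine (hg x).congr_of_eventuallyEq ?_
    filter_upwards [gt_mem_nhds hx] with p hp
    rw [if_neg (not_lt.2 (le_of_lt hp))]

theorem continuous_glue {f g : ℝ → ℝ} {a : ℝ} (hf : Continuous f) (hg : Continuous g)
    (h : f a = g a) : Continuous (fun p => if a < p then f p else g p) := by
  have : (fun p => if a < p then f p else g p) = fun p => if p ≤ a then g p else f p := by
    funext p
    by_cases hp : a < p
    · rw [if_pos hp, if_neg (not_le.2 hp)]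
    · rw [if_neg hp, if_pos (not_lt.1 hp)]
  rw [this]
  exact hg.if_le hf continuous_id continuous_const (fun x hx => by rw [hx]; exact h.symm)

/-- The piecewise derivative of order `α` of the smooth profile. -/
noncomputable def profileDeriv (k α : ℕ) (p : ℝ) : ℝ :=
  if 0 < p then (-1) ^ α * rexp (-p) else
    if -1 < p then (derivative^[α] (hermitePoly k)).eval p else rexp p

theorem profileDeriv_zero (k : ℕ) : profileDeriv k 0 = smoothProfile k := by
  funext p
  have h := (hermitePoly_spec k).at_neg_one 0 (Nat.zero_le _)
  simp only [Function.iterate_zero, id] at h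
  simp only [profileDeriv, smoothProfile, pow_zero, one_mul, Function.iterate_zero, id]
  -- The two definitions put the point `-1` in different branches; the Hermite condition of order 0
  -- reconciles them.
  rcases lt_trichotomy (-1) p with hp | rfl | hp
  · rw [if_pos hp, if_pos hp.le]
  · rw [if_neg (lt_irrefl (-1 : ℝ)), if_pos le_rfl, h]
  · rw [if_neg (not_lt.2 hp.le), if_neg (not_le.2 hp)]

theorem hasDerivAt_profileDeriv {k α : ℕ} (h : α < k) (p : ℝ) :
    HasDerivAt (profileDeriv k α) (profileDeriv k (α + 1) p) p := by
  have spec := hermitePoly_spec k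
  refine hasDerivAt_glue (a := 0)
    (f := fun p => (-1) ^ α * rexp (-p)) (f' := fun p => (-1) ^ (α + 1) * rexp (-p))
    (g := fun p => if -1 < p then (derivative^[α] (hermitePoly k)).eval p else rexp p)
    (g' := fun p => if -1 < p then (derivative^[α + 1] (hermitePoly k)).eval p else rexp p)
    (fun x => ?_) (fun x => ?_) ?_ ?_ p
  · have := ((hasDerivAt_neg x).exp).const_mul ((-1 : ℝ) ^ α)
    exact this.congr_deriv (by ring)
  · refine hasDerivAt_glue (a := -1) (f := fun p => (derivative^[α] (hermitePoly k)).eval p)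
      (f' := fun p => (derivative^[α + 1] (hermitePoly k)).eval p)
      (fun x => ?_) (fun x => Real.hasDerivAt_exp x) ?_ ?_ x
    · rw [Function.iterate_succ_apply']
      exact Polynomial.hasDerivAt _ _
    · exact spec.at_neg_one α h.le
    · exact spec.at_neg_one (α + 1) h
  · simp [spec.at_zero α h.le]
  · have := spec.at_zero (α + 1) h
    simp [this, -Function.iterate_succ]

theorem continuous_profileDeriv {k α : ℕ} (h : α ≤ k) : Continuous (profileDeriv k α) := by
  have spec := hermitePoly_spec k
  refine continuous_glue (by fun_prop)
    (continuous_glue (Polynomial.continuous _) Real.continuous_exp ?_) ?_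
  · rw [spec.at_neg_one α h]
  · simp [spec.at_zero α h]

/-- The induction runs over the smoothness still available, starting from the merely continuous
derivative of order `k` and integrating upwards. -/
theorem contDiff_profileDeriv (k : ℕ) : ∀ n ≤ k, ContDiff ℝ n (profileDeriv k (k - n)) := by
  intro n
  induction n with
  | zero =>
    intro _
    rw [Nat.cast_zero, contDiff_zero]
    exact continuous_profileDeriv (by omega)
  | succ n ih =>
    intro hn
    have hd : ∀ p, HasDerivAt (profileDeriv k (k - (n + 1))) (profileDeriv k (k - n) p) p := by
      intro p
      have := hasDerivAt_profileDeriv (k := k) (α := k - (n + 1)) (by omega) p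
      rwa [show k - (n + 1) + 1 = k - n by omega] at this
    rw [Nat.cast_add_one, contDiff_succ_iff_deriv]
    refine ⟨fun p => (hd p).differentiableAt, by simp, ?_⟩
    rw [show deriv (profileDeriv k (k - (n + 1))) = profileDeriv k (k - n) from
      funext fun p => (hd p).deriv]
    exact ih (by omega)

theorem contDiff_smoothProfile (k : ℕ) : ContDiff ℝ k (smoothProfile k) := by
  have := contDiff_profileDeriv k k le_rfl
  rwa [Nat.sub_self, profileDeriv_zero] at this

theorem continuous_smoothProfile (k : ℕ) : Continuous (smoothProfile k) :=
  (contDiff_smoothProfile k).continuous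

/-- Orders up to `k + 2` are included because the Fourier decay estimate integrates by parts once
after the order `k + 1` is reached. -/
theorem exists_abs_eval_le (k : ℕ) : ∃ B : ℝ, 1 ≤ B ∧ ∀ α ≤ k + 2, ∀ p ∈ Set.Icc (-1 : ℝ) 0,
    |(derivative^[α] (hermitePoly k)).eval p| ≤ B := by
  have h : ∀ α : ℕ, ∃ B : ℝ, ∀ p ∈ Set.Icc (-1 : ℝ) 0,
      |(derivative^[α] (hermitePoly k)).eval p| ≤ B := fun α =>
    isCompact_Icc.exists_bound_of_continuousOn (Polynomial.continuous _).continuousOn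
  choose B hB using h
  refine ⟨1 + ∑ α ∈ Finset.range (k + 3), |B α|, ?_, fun α hα p hp => ?_⟩
  · have := Finset.sum_nonneg fun α (_ : α ∈ Finset.range (k + 3)) => abs_nonneg (B α)
    linarith
  · have := Finset.single_le_sum (f := fun α => |B α|) (fun α _ => abs_nonneg _)
      (Finset.mem_range.2 (show α < k + 3 by omega))
    have h2 := hB α p hp
    have h3 := le_abs_self (B α)
    linarith

theorem exists_abs_smoothProfile_le (k : ℕ) : ∃ B : ℝ, 1 ≤ B ∧ ∀ p, |smoothProfile k p| ≤ B := by
  obtain ⟨B, hB1, hB⟩ := exists_abs_eval_le k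
  refine ⟨B, hB1, fun p => ?_⟩
  rw [smoothProfile]
  split_ifs with h1 h2
  · rw [abs_of_pos (exp_pos _)]
    exact (Real.exp_le_one_iff.2 (by linarith)).trans hB1
  · exact hB 0 (by omega) p ⟨h2, not_lt.1 h1⟩
  · rw [abs_of_pos (exp_pos _)]
    exact (Real.exp_le_one_iff.2 (by linarith)).trans hB1

theorem smoothProfile_of_nonneg (k : ℕ) {p : ℝ} (hp : 0 ≤ p) : smoothProfile k p = rexp (-p) := by
  rcases eq_or_lt_of_le hp with rfl | hp
  · have := (hermitePoly_spec k).at_zero 0 (Nat.zero_le _)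
    simp only [Function.iterate_zero, id, pow_zero] at this
    simp [smoothProfile, this]
  · rw [smoothProfile, if_pos hp]

theorem smoothProfile_of_le_neg_one (k : ℕ) {p : ℝ} (hp : p ≤ -1) :
    smoothProfile k p = rexp p := by
  have h := (hermitePoly_spec k).at_neg_one 0 (Nat.zero_le _)
  simp only [Function.iterate_zero, id] at h
  rw [smoothProfile, if_neg (by linarith)]
  rcases eq_or_lt_of_le hp with rfl | hp
  · rw [if_pos le_rfl, h]
  · rw [if_neg (not_le.2 hp)]

/-! ### The Fourier transform of the smooth profile -/

/-- The Fourier transform of the piecewise derivative of order `α` of the smooth profile. -/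
noncomputable def profileHat (k α : ℕ) (ξ : ℝ) : ℂ :=
  (-1) ^ α / (1 + Complex.I * ξ) + Complex.exp (Complex.I * ξ - 1) / (1 - Complex.I * ξ) +
    ∫ p in (-1 : ℝ)..0,
      (((derivative^[α] (hermitePoly k)).eval p : ℝ) : ℂ) * Complex.exp (-(Complex.I * ξ * p))

theorem one_le_norm_one_add (ξ : ℝ) : 1 ≤ ‖(1 : ℂ) + Complex.I * ξ‖ := by
  have := Complex.abs_re_le_norm ((1 : ℂ) + Complex.I * ξ)
  simpa using this

theorem one_le_norm_one_sub (ξ : ℝ) : 1 ≤ ‖(1 : ℂ) - Complex.I * ξ‖ := by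
  have := Complex.abs_re_le_norm ((1 : ℂ) - Complex.I * ξ)
  simpa using this

theorem abs_le_norm_one_add (ξ : ℝ) : |ξ| ≤ ‖(1 : ℂ) + Complex.I * ξ‖ := by
  have := Complex.abs_im_le_norm ((1 : ℂ) + Complex.I * ξ)
  simpa using this

theorem abs_le_norm_one_sub (ξ : ℝ) : |ξ| ≤ ‖(1 : ℂ) - Complex.I * ξ‖ := by
  have := Complex.abs_im_le_norm ((1 : ℂ) - Complex.I * ξ)
  simpa using this

theorem one_add_ne_zero (ξ : ℝ) : (1 : ℂ) + Complex.I * ξ ≠ 0 :=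
  norm_pos_iff.1 (zero_lt_one.trans_le (one_le_norm_one_add ξ))

theorem one_sub_ne_zero (ξ : ℝ) : (1 : ℂ) - Complex.I * ξ ≠ 0 :=
  norm_pos_iff.1 (zero_lt_one.trans_le (one_le_norm_one_sub ξ))

theorem norm_exp_neg_I_mul (ξ p : ℝ) : ‖Complex.exp (-(Complex.I * ξ * p))‖ = 1 := by
  rw [show -(Complex.I * ξ * p) = ((-(ξ * p) : ℝ) : ℂ) * Complex.I by push_cast; ring,
    Complex.norm_exp_ofReal_mul_I]

theorem hasDerivAt_exp_neg_I_mul (ξ p : ℝ) :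
    HasDerivAt (fun p : ℝ => Complex.exp (-(Complex.I * ξ * p)))
      (Complex.exp (-(Complex.I * ξ * p)) * -(Complex.I * ξ)) p := by
  have h : HasDerivAt (fun p : ℝ => -(Complex.I * ξ * p)) (-(Complex.I * ξ)) p := by
    have := ((hasDerivAt_id p).ofReal_comp.const_mul (Complex.I * ξ)).fun_neg
    simpa using this
  exact h.cexp

theorem I_mul_integral_poly (P : ℝ[X]) (ξ : ℝ) :
    Complex.I * ξ * ∫ p in (-1 : ℝ)..0, ((P.eval p : ℝ) : ℂ) * Complex.exp (-(Complex.I * ξ * p)) =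
      -(P.eval 0 : ℝ) + (P.eval (-1) : ℝ) * Complex.exp (Complex.I * ξ) +
      ∫ p in (-1 : ℝ)..0,
        (((derivative P).eval p : ℝ) : ℂ) * Complex.exp (-(Complex.I * ξ * p)) := by
  have hd : ∀ p : ℝ, HasDerivAt
      (fun p : ℝ => ((P.eval p : ℝ) : ℂ) * Complex.exp (-(Complex.I * ξ * p)))
      ((((derivative P).eval p : ℝ) : ℂ) * Complex.exp (-(Complex.I * ξ * p)) +
        ((P.eval p : ℝ) : ℂ) * (Complex.exp (-(Complex.I * ξ * p)) * -(Complex.I * ξ))) p :=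
    fun p => (Polynomial.hasDerivAt P p).ofReal_comp.mul (hasDerivAt_exp_neg_I_mul ξ p)
  have hc1 : Continuous fun p : ℝ =>
      (((derivative P).eval p : ℝ) : ℂ) * Complex.exp (-(Complex.I * ξ * p)) := by
    have := (derivative P).continuous
    fun_prop
  have hc2 : Continuous fun p : ℝ =>
      ((P.eval p : ℝ) : ℂ) * (Complex.exp (-(Complex.I * ξ * p)) * -(Complex.I * ξ)) := by
    have := P.continuous
    fun_prop
  have h := intervalIntegral.integral_eq_sub_of_hasDerivAt (a := -1) (b := 0)
    (fun p _ => hd p) ((hc1.add hc2).intervalIntegrable _ _)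
  rw [intervalIntegral.integral_add (hc1.intervalIntegrable _ _) (hc2.intervalIntegrable _ _)] at h
  simp only [← mul_assoc] at h
  rw [intervalIntegral.integral_mul_const] at h
  simp only [Complex.ofReal_zero, mul_zero, neg_zero, Complex.exp_zero, mul_one,
    Complex.ofReal_neg, Complex.ofReal_one, mul_neg, neg_neg] at h
  linear_combination -h

theorem norm_integral_poly_le {P : ℝ[X]} {B : ℝ} (hB : ∀ p ∈ Set.Icc (-1 : ℝ) 0, |P.eval p| ≤ B)
    (ξ : ℝ) : ‖∫ p in (-1 : ℝ)..0, ((P.eval p : ℝ) : ℂ) * Complex.exp (-(Complex.I * ξ * p))‖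
      ≤ B := by
  have := intervalIntegral.norm_integral_le_of_norm_le_const (a := -1) (b := 0) (C := B)
    (f := fun p : ℝ => ((P.eval p : ℝ) : ℂ) * Complex.exp (-(Complex.I * ξ * p))) (fun p hp => by
      rw [Set.uIoc_of_le (by norm_num)] at hp
      rw [norm_mul, norm_exp_neg_I_mul, mul_one, Complex.norm_real]
      exact hB p ⟨hp.1.le, hp.2⟩)
  simpa using this

/-- The boundary terms of the polynomial piece at `0` and `-1` cancel those of the two exponentials,
by the Hermite conditions of order `α`. The case `α = k` is allowed, since only continuity of the
`k`-th derivative is needed. -/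
theorem I_mul_profileHat {k α : ℕ} (h : α ≤ k) (ξ : ℝ) :
    Complex.I * ξ * profileHat k α ξ = profileHat k (α + 1) ξ := by
  have spec := hermitePoly_spec k
  rw [profileHat, mul_add, I_mul_integral_poly, spec.at_zero α h, spec.at_neg_one α h, profileHat,
    Function.iterate_succ_apply', Complex.exp_sub]
  have h1 := one_add_ne_zero ξ
  have h2 := one_sub_ne_zero ξ
  have h3 := Complex.exp_ne_zero 1
  push_cast
  rw [Complex.exp_neg]
  field_simp
  ring

theorem norm_exp_I_mul_sub_one_le (ξ : ℝ) : ‖Complex.exp (Complex.I * ξ - 1)‖ ≤ 1 := by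
  rw [Complex.norm_exp]
  simp

/-- The first `k + 1` factors `iξ` are absorbed as derivatives without boundary terms. One further
factor is absorbed by each of the three pieces separately: the jumps now leave boundary terms, but
these stay bounded in `ξ`. -/
theorem exists_norm_profileHat_le (k : ℕ) : ∃ D : ℝ, 0 < D ∧ ∀ ξ : ℝ,
    ‖profileHat k 0 ξ‖ ≤ D ∧ |ξ| ^ (k + 2) * ‖profileHat k 0 ξ‖ ≤ D := by
  obtain ⟨B, hB1, hB⟩ := exists_abs_eval_le k
  have hdiv : ∀ a b : ℂ, ‖a‖ ≤ 1 → 1 ≤ ‖b‖ → ‖a / b‖ ≤ 1 := by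
    intro a b ha hb
    rw [norm_div]
    exact div_le_one_of_le₀ (ha.trans hb) (norm_nonneg _)
  have hdiv' : ∀ (a b : ℂ) (ξ : ℝ), ‖a‖ ≤ 1 → 1 ≤ ‖b‖ → |ξ| ≤ ‖b‖ →
      ‖Complex.I * ξ * (a / b)‖ ≤ 1 := by
    intro a b ξ ha hb hξ
    rw [norm_mul, norm_mul, norm_div, Complex.norm_I, one_mul, Complex.norm_real, Real.norm_eq_abs,
      ← mul_div_assoc]
    apply div_le_one_of_le₀ _ (norm_nonneg _)
    nlinarith [abs_nonneg ξ, norm_nonneg a]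
  -- The 2 pays for the two exponential pieces, and `3 * B` for two boundary values and one integral
  -- of the polynomial piece.
  refine ⟨3 * B + 2, by linarith, fun ξ => ⟨?_, ?_⟩⟩
  · rw [profileHat]
    refine (norm_add₃_le).trans ?_
    have h1 := hdiv ((-1) ^ 0) _ (by simp) (one_le_norm_one_add ξ)
    have h2 := hdiv _ _ (norm_exp_I_mul_sub_one_le ξ) (one_le_norm_one_sub ξ)
    have h3 := norm_integral_poly_le (hB 0 (by omega)) ξ
    linarith
  · have hiter : ∀ n ≤ k + 1, (Complex.I * ξ) ^ n * profileHat k 0 ξ = profileHat k n ξ := by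
      intro n
      induction n with
      | zero => simp
      | succ n ih =>
        intro hn
        rw [pow_succ', mul_assoc, ih (by omega), I_mul_profileHat (by omega)]
    have h1 : |ξ| ^ (k + 2) * ‖profileHat k 0 ξ‖ = ‖Complex.I * ξ * profileHat k (k + 1) ξ‖ := by
      rw [← hiter (k + 1) le_rfl, ← mul_assoc, ← pow_succ', norm_mul, norm_pow, norm_mul,
        Complex.norm_I, one_mul, Complex.norm_real, Real.norm_eq_abs]
    rw [h1, profileHat, mul_add, mul_add, I_mul_integral_poly, ← Function.iterate_succ_apply' derivative]
    have h2 := hdiv' ((-1) ^ (k + 1)) _ ξ (by simp) (one_le_norm_one_add ξ) (abs_le_norm_one_add ξ)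
    have h3 := hdiv' _ _ ξ (norm_exp_I_mul_sub_one_le ξ) (one_le_norm_one_sub ξ)
      (abs_le_norm_one_sub ξ)
    have h4 := norm_integral_poly_le (hB (k + 2) (by omega)) ξ
    have h5 : ‖-((eval 0 (derivative^[k + 1] (hermitePoly k)) : ℝ) : ℂ)‖ ≤ B := by
      rw [norm_neg, Complex.norm_real]
      exact hB (k + 1) (by omega) 0 (by simp)
    have h6 : ‖((eval (-1) (derivative^[k + 1] (hermitePoly k)) : ℝ) : ℂ) *
        Complex.exp (Complex.I * ξ)‖ ≤ B := by
      rw [norm_mul, mul_comm Complex.I, Complex.norm_exp_ofReal_mul_I, Complex.norm_real, mul_one]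
      exact hB (k + 1) (by omega) (-1) (by simp)
    refine (norm_add₃_le).trans ?_
    have h7 := norm_add₃_le (a := -((eval 0 (derivative^[k + 1] (hermitePoly k)) : ℝ) : ℂ))
      (b := ((eval (-1) (derivative^[k + 1] (hermitePoly k)) : ℝ) : ℂ) *
        Complex.exp (Complex.I * ξ))
      (c := ∫ p in (-1 : ℝ)..0, (((derivative^[(k + 1).succ] (hermitePoly k)).eval p : ℝ) : ℂ) *
        Complex.exp (-(Complex.I * ξ * p)))
    linarith

theorem integral_exp_mul_cexp (a b σ ξ : ℝ) (h : (σ : ℂ) - Complex.I * ξ ≠ 0) :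
    ∫ p in a..b, Complex.exp (-(Complex.I * ξ * p)) * ((rexp (σ * p) : ℝ) : ℂ) =
      (Complex.exp ((σ - Complex.I * ξ) * b) - Complex.exp ((σ - Complex.I * ξ) * a)) /
        (σ - Complex.I * ξ) := by
  rw [← integral_exp_mul_complex h]
  congr 1
  funext p
  push_cast
  rw [← Complex.exp_add]
  congr 1
  ring

/-- The subtracted terms are the transforms of the two exponential tails outside `[-R, R]`; `1 ≤ R`
keeps the polynomial piece inside. -/
theorem integral_smoothProfile (k : ℕ) {R : ℝ} (hR : 1 ≤ R) (ξ : ℝ) :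
    ∫ p in (-R)..R, Complex.exp (-(Complex.I * ξ * p)) * ((smoothProfile k p : ℝ) : ℂ) =
      profileHat k 0 ξ - rexp (-R) * (Complex.exp (-(Complex.I * ξ * R)) / (1 + Complex.I * ξ) +
        Complex.exp (Complex.I * ξ * R) / (1 - Complex.I * ξ)) := by
  have hcont := continuous_smoothProfile k
  have hc : Continuous fun p : ℝ =>
      Complex.exp (-(Complex.I * ξ * p)) * ((smoothProfile k p : ℝ) : ℂ) := by fun_prop
  rw [← intervalIntegral.integral_add_adjacent_intervals (hc.intervalIntegrable (-R) (-1))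
    (hc.intervalIntegrable (-1) R), ← intervalIntegral.integral_add_adjacent_intervals
    (hc.intervalIntegrable (-1) 0) (hc.intervalIntegrable 0 R)]
  have e1 : ∫ p in (-R)..(-1), Complex.exp (-(Complex.I * ξ * p)) * ((smoothProfile k p : ℝ) : ℂ) =
      ∫ p in (-R)..(-1), Complex.exp (-(Complex.I * ξ * p)) * ((rexp (1 * p) : ℝ) : ℂ) := by
    refine intervalIntegral.integral_congr fun p hp => ?_
    rw [Set.uIcc_of_le (by linarith)] at hp
    rw [smoothProfile_of_le_neg_one k hp.2, one_mul]
  have e2 : ∫ p in (0 : ℝ)..R, Complex.exp (-(Complex.I * ξ * p)) * ((smoothProfile k p : ℝ) : ℂ) =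
      ∫ p in (0 : ℝ)..R, Complex.exp (-(Complex.I * ξ * p)) * ((rexp (-1 * p) : ℝ) : ℂ) := by
    refine intervalIntegral.integral_congr fun p hp => ?_
    rw [Set.uIcc_of_le (by linarith)] at hp
    rw [smoothProfile_of_nonneg k hp.1, neg_one_mul]
  have e3 : ∫ p in (-1 : ℝ)..0, Complex.exp (-(Complex.I * ξ * p)) * ((smoothProfile k p : ℝ) : ℂ) =
      ∫ p in (-1 : ℝ)..0, (((derivative^[0] (hermitePoly k)).eval p : ℝ) : ℂ) *
        Complex.exp (-(Complex.I * ξ * p)) := by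
    refine intervalIntegral.integral_congr fun p hp => ?_
    rw [Set.uIcc_of_le (by norm_num)] at hp
    simp only [Function.iterate_zero, id]
    rw [smoothProfile, if_neg (not_lt.2 hp.2), if_pos hp.1, mul_comm]
  have h1 := one_add_ne_zero ξ
  have h2 := one_sub_ne_zero ξ
  have h1' : ((-1 : ℝ) : ℂ) - Complex.I * ξ ≠ 0 := by
    intro h
    apply h1
    push_cast at h
    linear_combination -h
  rw [e1, e2, e3, integral_exp_mul_cexp _ _ _ _ (by simpa using h2),
    integral_exp_mul_cexp _ _ _ _ h1', profileHat]
  have a1 : Complex.exp ((((1 : ℝ) : ℂ) - Complex.I * ξ) * ((-1 : ℝ) : ℂ)) =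
      Complex.exp (Complex.I * ξ - 1) := by congr 1; push_cast; ring
  have a2 : Complex.exp ((((1 : ℝ) : ℂ) - Complex.I * ξ) * ((-R : ℝ) : ℂ)) =
      rexp (-R) * Complex.exp (Complex.I * ξ * R) := by
    push_cast; rw [← Complex.exp_add]; congr 1; ring
  have a3 : Complex.exp ((((-1 : ℝ) : ℂ) - Complex.I * ξ) * (R : ℂ)) =
      rexp (-R) * Complex.exp (-(Complex.I * ξ * R)) := by
    push_cast; rw [← Complex.exp_add]; congr 1; ring
  rw [a1, a2, a3]
  have a4 : ((-1 : ℝ) : ℂ) - Complex.I * ξ = -(1 + Complex.I * ξ) := by push_cast; ring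
  rw [a4, div_neg]
  simp only [Complex.ofReal_one, Complex.ofReal_zero, mul_zero, Complex.exp_zero, pow_zero]
  field_simp
  ring

theorem norm_integral_smoothProfile_le (k : ℕ) {L : ℝ} (hL : 1 ≤ π * L) (n : ℤ) :
    ‖∫ p in (-(π * L))..(π * L),
        Complex.exp (-(Complex.I * ((n / L : ℝ) : ℂ) * p)) * ((smoothProfile k p : ℝ) : ℂ)‖ ≤
      ‖profileHat k 0 (n / L)‖ + 2 * rexp (-(π * L)) / (1 + (n / L) ^ 2) := by
  have hL0 : 0 < L := by
    by_contra h
    nlinarith [Real.pi_pos]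
  set ξ : ℝ := n / L with hξ
  rw [integral_smoothProfile k hL ξ]
  -- At a frequency of the periodic box the two phases differ by `2πn`. The two tails, each of order
  -- `1/ξ`, then combine into one term of order `1/ξ²`, which is summable.
  have e : Complex.exp (Complex.I * ξ * (π * L : ℝ)) =
      Complex.exp (-(Complex.I * ξ * (π * L : ℝ))) := by
    rw [Complex.exp_eq_exp_iff_exists_int]
    refine ⟨n, ?_⟩
    rw [hξ]
    have : (L : ℂ) ≠ 0 := by exact_mod_cast hL0.ne'
    push_cast
    field_simp
    ring
  have h1 := one_add_ne_zero ξ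
  have h2 := one_sub_ne_zero ξ
  have h3 : ((1 + ξ ^ 2 : ℝ) : ℂ) ≠ 0 := by
    have : (1 + ξ ^ 2 : ℝ) ≠ 0 := by positivity
    exact_mod_cast this
  have h4 : (1 + Complex.I * ξ) * (1 - Complex.I * ξ) = ((1 + ξ ^ 2 : ℝ) : ℂ) := by
    push_cast
    linear_combination (-(ξ : ℂ) ^ 2) * Complex.I_sq
  have e2 : Complex.exp (-(Complex.I * ξ * (π * L : ℝ))) / (1 + Complex.I * ξ) +
        Complex.exp (Complex.I * ξ * (π * L : ℝ)) / (1 - Complex.I * ξ) =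
      2 * Complex.exp (-(Complex.I * ξ * (π * L : ℝ))) / ((1 + ξ ^ 2 : ℝ) : ℂ) := by
    rw [e, ← h4]
    field_simp
    ring
  rw [e2]
  refine (norm_sub_le _ _).trans (add_le_add le_rfl ?_)
  rw [norm_mul, norm_div, norm_mul, norm_exp_neg_I_mul, Complex.norm_real, Complex.norm_real,
    Real.norm_of_nonneg (exp_pos _).le, Real.norm_of_nonneg (by positivity)]
  apply le_of_eq
  simp
  ring

/-! ### Sums over the integers -/

theorem summable_inv_int_sq : Summable fun n : ℤ => ((n : ℝ) ^ 2)⁻¹ := by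
  simpa using Real.summable_one_div_int_pow.2 (show 1 < 2 by norm_num)

theorem sum_range_indicator_inv_sq_le {A : ℕ} (hA : 0 < A) (m : ℕ) :
    ∑ i ∈ Finset.range m, (if A ≤ i then ((i : ℝ) ^ 2)⁻¹ else 0) ≤ 2 / A := by
  rw [← Finset.sum_filter]
  have h := sum_Ioo_inv_sq_le (α := ℝ) (A - 1) m
  have hA' : ((A - 1 : ℕ) : ℝ) + 1 = A := by
    have : (A - 1) + 1 = A := by omega
    exact_mod_cast this
  rw [hA'] at h
  refine le_trans (le_of_eq ?_) h
  congr 1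
  ext i
  simp only [Finset.mem_filter, Finset.mem_range, Finset.mem_Ioo]
  omega

theorem tsum_indicator_inv_sq_le {A : ℕ} (hA : 0 < A) :
    ∑' n : ℤ, {n : ℤ | (A : ℤ) ≤ |n|}.indicator (fun n : ℤ => ((n : ℝ) ^ 2)⁻¹) n ≤ 4 / A := by
  have hs := summable_inv_int_sq.indicator {n : ℤ | (A : ℤ) ≤ |n|}
  have hpos : ∀ n : ℤ, 0 ≤ {n : ℤ | (A : ℤ) ≤ |n|}.indicator (fun n : ℤ => ((n : ℝ) ^ 2)⁻¹) n :=
    fun n => Set.indicator_nonneg (fun _ _ => by positivity) _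
  have h1 : ∀ i : ℕ, {n : ℤ | (A : ℤ) ≤ |n|}.indicator (fun n : ℤ => ((n : ℝ) ^ 2)⁻¹) (i : ℤ) =
      if A ≤ i then ((i : ℝ) ^ 2)⁻¹ else 0 := by
    intro i
    simp [Set.indicator_apply]
  have h2 : ∀ i : ℕ, {n : ℤ | (A : ℤ) ≤ |n|}.indicator (fun n : ℤ => ((n : ℝ) ^ 2)⁻¹)
      (-((i : ℤ) + 1)) = if A ≤ i + 1 then (((i + 1 : ℕ) : ℝ) ^ 2)⁻¹ else 0 := by
    intro i
    have e : |(-1 : ℤ) + -(i : ℤ)| = i + 1 := by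
      rw [abs_of_nonpos (by omega)]; ring
    have e2 : ((-1 : ℝ) + -(i : ℝ)) ^ 2 = ((i : ℝ) + 1) ^ 2 := by ring
    simp only [Set.indicator_apply, Set.mem_ofPred_eq, neg_add_rev, e]
    push_cast
    rw [e2]
    norm_cast
  rw [tsum_of_nat_of_neg_add_one (hs.comp_injective Nat.cast_injective)
    (hs.comp_injective (i := fun i : ℕ => (-((i : ℤ) + 1)))
      (fun a b h => by simpa using h))]
  have h3 := Real.tsum_le_of_sum_range_le (fun i : ℕ => hpos i) (c := 2 / A) fun m => by
    simp only [h1]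
    exact sum_range_indicator_inv_sq_le hA m
  have h4 := Real.tsum_le_of_sum_range_le (fun i : ℕ => hpos (-((i : ℤ) + 1))) (c := 2 / A)
    fun m => by
      simp only [h2]
      -- Negative integers are indexed by `-(i + 1)`, so the range grows by one; the extra term at
      -- `0` vanishes since `A > 0`.
      have h := sum_range_indicator_inv_sq_le hA (m + 1)
      rw [Finset.sum_range_succ'] at h
      rw [if_neg (by omega), add_zero] at h
      exact h
  calc _ ≤ (2 : ℝ) / A + 2 / A := add_le_add h3 h4
    _ = 4 / A := by ring

theorem summable_inv_one_add_sq {L : ℝ} (hL : 0 < L) :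
    Summable fun n : ℤ => (1 + ((n : ℝ) / L) ^ 2)⁻¹ := by
  refine Summable.of_norm_bounded_eventually (summable_inv_int_sq.mul_left (L ^ 2)) ?_
  have : ({0}ᶜ : Set ℤ) ∈ Filter.cofinite := (Set.finite_singleton 0).compl_mem_cofinite
  filter_upwards [this] with n hn
  have hn' : (n : ℝ) ≠ 0 := by exact_mod_cast hn
  rw [Real.norm_of_nonneg (by positivity), ← div_eq_mul_inv, inv_le_comm₀ (by positivity)
    (by positivity), inv_div, div_pow]
  linarith

/-- Splitting at `A = ⌈L⌉`, the `2A - 1` central terms are at most 1 each, and the rest is at most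
`L² · 4/A ≤ 4L`. The linear growth in `L` is what the factor `1/L` of the coefficients will cancel.
-/
theorem tsum_inv_one_add_sq_le {L : ℝ} (hL : 0 < L) :
    ∑' n : ℤ, (1 + ((n : ℝ) / L) ^ 2)⁻¹ ≤ 6 * L + 2 := by
  set A := ⌈L⌉₊ with hA
  have hA0 : 0 < A := Nat.ceil_pos.2 hL
  have hLA : L ≤ A := Nat.le_ceil L
  have hAL : (A : ℝ) < L + 1 := Nat.ceil_lt_add_one hL.le
  let F : ℤ → ℝ := fun n => if n ∈ Finset.Ioo (-(A : ℤ)) A then 1 else 0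
  let G : ℤ → ℝ := fun n =>
    L ^ 2 * {n : ℤ | (A : ℤ) ≤ |n|}.indicator (fun n : ℤ => ((n : ℝ) ^ 2)⁻¹) n
  have hF : HasSum F (2 * A - 1) := by
    have h : HasSum F _ := hasSum_sum_of_ne_finset_zero (s := Finset.Ioo (-(A : ℤ)) A)
      (fun n hn => by simp only [F, if_neg hn])
    convert h using 1
    rw [Finset.sum_congr rfl (fun n hn => by simp only [F]; rw [if_pos hn]), Finset.sum_const,
      Int.card_Ioo, nsmul_eq_mul, mul_one]
    have : ((A : ℤ) - -(A : ℤ) - 1).toNat = 2 * A - 1 := by omega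
    rw [this, Nat.cast_sub (by omega)]
    push_cast
    ring
  have hG : Summable G := (summable_inv_int_sq.indicator _).mul_left _
  have hle : ∀ n : ℤ, (1 + ((n : ℝ) / L) ^ 2)⁻¹ ≤ F n + G n := by
    intro n
    by_cases hn : (A : ℤ) ≤ |n|
    · have hFn : 0 ≤ F n := by simp only [F]; split_ifs <;> norm_num
      have hn0 : (n : ℝ) ≠ 0 := by
        have : n ≠ 0 := by rintro rfl; simp at hn; omega
        exact_mod_cast this
      have : G n = L ^ 2 * ((n : ℝ) ^ 2)⁻¹ := by
        simp only [G]
        rw [Set.indicator_of_mem (by exact hn)]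
      rw [this]
      have h2 : (1 + ((n : ℝ) / L) ^ 2)⁻¹ ≤ L ^ 2 * ((n : ℝ) ^ 2)⁻¹ := by
        rw [← div_eq_mul_inv, inv_le_comm₀ (by positivity) (by positivity), inv_div, div_pow]
        linarith
      linarith
    · have h1 : F n = 1 := by
        simp only [F]
        rw [if_pos]
        rw [Finset.mem_Ioo, ← abs_lt]
        exact not_le.1 hn
      have h2 : 0 ≤ G n :=
        mul_nonneg (sq_nonneg _) (Set.indicator_nonneg (fun _ _ => by positivity) _)
      have h3 : (1 + ((n : ℝ) / L) ^ 2)⁻¹ ≤ 1 := inv_le_one_of_one_le₀ (by nlinarith [sq_nonneg ((n : ℝ) / L)])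
      linarith
  have h1 := (summable_inv_one_add_sq hL).tsum_le_tsum hle (hF.summable.add hG)
  rw [hF.summable.tsum_add hG, hF.tsum_eq, tsum_mul_left] at h1
  have h2 := mul_le_mul_of_nonneg_left (tsum_indicator_inv_sq_le hA0) (sq_nonneg L)
  have h3 : L ^ 2 * (4 / A) ≤ 4 * L := by
    rw [mul_div_assoc', div_le_iff₀ (by positivity)]
    nlinarith
  linarith

/-! ### Fourier series of continuous functions with summable coefficients -/

theorem hasSum_fourierCoeffOn {a b : ℝ} (hab : a < b) {f : ℝ → ℂ}
    (hf : ContinuousOn f (Set.Icc a b)) (hend : f a = f b)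
    (hs : Summable fun n => ‖fourierCoeffOn hab f n‖) {p : ℝ} (hp : p ∈ Set.Icc a b) :
    HasSum (fun n => fourierCoeffOn hab f n * fourier n (p : AddCircle (b - a))) (f p) := by
  have := Fact.mk (by linarith : 0 < b - a)
  have hb : a + (b - a) = b := by ring
  let F : C(AddCircle (b - a), ℂ) := ⟨AddCircle.liftIoc (b - a) a f,
    AddCircle.liftIoc_continuous (by rw [hb, hend]) (by rwa [hb])⟩
  have hF : ∀ n, fourierCoeff F n = fourierCoeffOn hab f n := fun n => rfl
  have hsF : Summable (fourierCoeff F) := by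
    refine Summable.of_norm ?_
    simpa only [hF] using hs
  have key : ∀ q ∈ Set.Ioc a b,
      HasSum (fun n => fourierCoeffOn hab f n * fourier n (q : AddCircle (b - a))) (f q) := by
    intro q hq
    have h := has_pointwise_sum_fourier_series_of_summable hsF (q : AddCircle (b - a))
    have e : F (q : AddCircle (b - a)) = f q :=
      AddCircle.liftIoc_coe_apply (by rwa [hb])
    rw [e] at h
    exact h
  -- The lift to the circle uses the interval open at the left, so the left endpoint is reached
  -- through its identification with the right one.
  rcases eq_or_lt_of_le hp.1 with rfl | hlt
  · have h := key b ⟨hab, le_rfl⟩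
    rw [← hend] at h
    have e : (b : AddCircle (b - a)) = (a : AddCircle (b - a)) := by
      have := AddCircle.coe_add_period (b - a) a
      rwa [hb] at this
    rwa [e] at h
  · exact key p ⟨hlt, hp.2⟩

/-- Fourier coefficients with respect to the functions `wave L n`. -/
noncomputable def waveCoeff (L : ℝ) (f : ℝ → ℂ) (n : ℤ) : ℂ :=
  Complex.exp (-(Complex.I * n * π)) * ((1 / (2 * π * L) : ℝ) *
    ∫ p in (-(π * L))..(π * L), Complex.exp (-(Complex.I * ((n / L : ℝ) : ℂ) * p)) * f p)

theorem norm_exp_int_mul_pi (n : ℤ) : ‖Complex.exp (-(Complex.I * n * π))‖ = 1 := by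
  have := norm_exp_neg_I_mul n π
  simpa using this

theorem fourierCoeffOn_eq_waveCoeff {a b : ℝ} (hab : a < b) {L : ℝ} (hL : 0 < L)
    (ha : a = -(π * L)) (hb : b = π * L) (f : ℝ → ℂ) (n : ℤ) :
    fourierCoeffOn hab f n = Complex.exp (Complex.I * n * π) * waveCoeff L f n := by
  have hLc : (L : ℂ) ≠ 0 := by exact_mod_cast hL.ne'
  rw [fourierCoeffOn_eq_integral, waveCoeff, ← mul_assoc, ← Complex.exp_add, add_neg_cancel,
    Complex.exp_zero, one_mul]
  subst ha hb
  rw [show π * L - -(π * L) = 2 * π * L by ring, Complex.real_smul]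
  congr 2
  funext p
  rw [fourier_coe_apply, smul_eq_mul]
  congr 2
  have : (π : ℂ) ≠ 0 := by exact_mod_cast Real.pi_ne_zero
  push_cast
  field_simp

theorem fourier_eq_wave {L : ℝ} (hL : 0 < L) (n : ℤ) (p : ℝ) :
    fourier n (p : AddCircle (π * L - -(π * L))) =
      Complex.exp (-(Complex.I * n * π)) * wave L n p := by
  have hLc : (L : ℂ) ≠ 0 := by exact_mod_cast hL.ne'
  have : (π : ℂ) ≠ 0 := by exact_mod_cast Real.pi_ne_zero
  rw [fourier_coe_apply, wave, ← Complex.exp_add]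
  congr 1
  push_cast
  field_simp
  ring

theorem hasSum_wave {L : ℝ} (hL : 0 < L) {f : ℝ → ℂ}
    (hf : ContinuousOn f (Set.Icc (-(π * L)) (π * L))) (hend : f (-(π * L)) = f (π * L))
    (hs : Summable fun n => ‖waveCoeff L f n‖) {p : ℝ} (hp : p ∈ Set.Icc (-(π * L)) (π * L)) :
    HasSum (fun n => waveCoeff L f n * wave L n p) (f p) := by
  have hab : -(π * L) < π * L := by nlinarith [Real.pi_pos, mul_pos Real.pi_pos hL]
  have hc := fourierCoeffOn_eq_waveCoeff hab hL rfl rfl f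
  have hn : ∀ n : ℤ, ‖Complex.exp (Complex.I * n * π)‖ = 1 := fun n => by
    rw [← inv_inv (Complex.exp _), ← Complex.exp_neg, norm_inv, norm_exp_int_mul_pi, inv_one]
  have h := hasSum_fourierCoeffOn hab hf hend (by simpa only [hc, norm_mul, hn, one_mul] using hs) hp
  convert h using 2 with n
  rw [hc, fourier_eq_wave hL]
  have : Complex.exp (Complex.I * n * π) * Complex.exp (-(Complex.I * n * π)) = 1 := by
    rw [← Complex.exp_add, add_neg_cancel, Complex.exp_zero]
  linear_combination (-waveCoeff L f n * wave L n p) * this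

theorem pGrid_mem {L : ℝ} (hL : 0 < L) {N : ℕ} (i : Fin N) :
    pGrid L N i ∈ Set.Icc (-(π * L)) (π * L) := by
  have hN : (0 : ℝ) < N := by exact_mod_cast i.pos
  have hi : ((i : ℕ) : ℝ) ≤ N := by exact_mod_cast i.2.le
  have h1 : (0 : ℝ) ≤ i * (2 * π * L / N) := by positivity
  have h2 : (i : ℝ) * (2 * π * L / N) ≤ 2 * π * L := by
    rw [mul_div_assoc', div_le_iff₀ hN, mul_comm]
    exact mul_le_mul_of_nonneg_left hi (by positivity)
  rw [pGrid]
  constructor <;> linarith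

/-! ### Interpolation of the smooth profile on a long interval -/

/-- Nodal values of the smooth profile. -/
noncomputable def profileNodes (k : ℕ) (L : ℝ) (N : ℕ) (i : Fin N) : ℂ :=
  (smoothProfile k (pGrid L N i) : ℂ)

/-- The first bound serves summability and the uniform bound on the interpolant. The second, with
the full order `k + 2` and an exponentially small remainder, gives the rate. -/
theorem exists_norm_waveCoeff_profile_le (k : ℕ) : ∃ D : ℝ, 0 < D ∧ ∀ L : ℝ, 1 ≤ π * L → ∀ n : ℤ,
    ‖waveCoeff L (fun p => (smoothProfile k p : ℂ)) n‖ ≤ D / L * (1 + ((n : ℝ) / L) ^ 2)⁻¹ ∧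
    (n ≠ 0 → ‖waveCoeff L (fun p => (smoothProfile k p : ℂ)) n‖ ≤
      D / L * ((|(n : ℝ) / L| ^ (k + 2))⁻¹ + rexp (-(π * L)) * (1 + ((n : ℝ) / L) ^ 2)⁻¹)) := by
  obtain ⟨D, hD0, hD⟩ := exists_norm_profileHat_le k
  refine ⟨2 * D + 2, by linarith, fun L hL n => ?_⟩
  have hL0 : 0 < L := by
    by_contra h
    nlinarith [Real.pi_pos]
  obtain ⟨h1, h2⟩ := hD (n / L)
  have h3 := norm_integral_smoothProfile_le k hL n
  set ξ : ℝ := n / L with hξ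
  set H := ‖profileHat k 0 ξ‖ with hH
  have hH0 : 0 ≤ H := norm_nonneg _
  set J := ‖∫ p in (-(π * L))..(π * L),
        Complex.exp (-(Complex.I * ((ξ : ℝ) : ℂ) * p)) * ((smoothProfile k p : ℝ) : ℂ)‖ with hJ
  have hw : ‖waveCoeff L (fun p => (smoothProfile k p : ℂ)) n‖ = (1 / (2 * π * L)) * J := by
    rw [waveCoeff, norm_mul, norm_exp_int_mul_pi, one_mul, norm_mul, Complex.norm_real,
      Real.norm_of_nonneg (by positivity)]
  have hJ0 : 0 ≤ J := norm_nonneg _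
  have hw' : ‖waveCoeff L (fun p => (smoothProfile k p : ℂ)) n‖ ≤ 1 / L * J := by
    rw [hw]
    refine mul_le_mul_of_nonneg_right ?_ hJ0
    apply one_div_le_one_div_of_le hL0
    nlinarith [Real.pi_gt_three]
  have hxi : 0 < 1 + ξ ^ 2 := by positivity
  have hexp1 : rexp (-(π * L)) ≤ 1 := Real.exp_le_one_iff.2 (by linarith)
  have hexp0 := exp_pos (-(π * L))
  constructor
  · have h4 : ξ ^ 2 * H ≤ D := by
      rcases le_total |ξ| 1 with hle | hge
      · have : ξ ^ 2 ≤ 1 := by rw [← sq_abs]; exact pow_le_one₀ (abs_nonneg _) hle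
        nlinarith
      · have : ξ ^ 2 ≤ |ξ| ^ (k + 2) := by
          rw [← sq_abs]
          exact pow_le_pow_right₀ hge (by omega)
        nlinarith
    have h5 : J ≤ (2 * D + 2) * (1 + ξ ^ 2)⁻¹ := by
      rw [← div_eq_mul_inv, le_div_iff₀ hxi]
      have h6 : J * (1 + ξ ^ 2) ≤ (H + 2 * rexp (-(π * L)) / (1 + ξ ^ 2)) * (1 + ξ ^ 2) :=
        mul_le_mul_of_nonneg_right h3 hxi.le
      rw [add_mul, div_mul_cancel₀ _ hxi.ne'] at h6
      linarith
    refine hw'.trans ?_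
    calc 1 / L * J ≤ 1 / L * ((2 * D + 2) * (1 + ξ ^ 2)⁻¹) :=
          mul_le_mul_of_nonneg_left h5 (by positivity)
      _ = _ := by ring
  · intro hn
    have hξ0 : 0 < |ξ| := abs_pos.2 (div_ne_zero (by exact_mod_cast hn) hL0.ne')
    have hpow : 0 < |ξ| ^ (k + 2) := by positivity
    have h5 : H ≤ D * (|ξ| ^ (k + 2))⁻¹ := by
      rw [← div_eq_mul_inv, le_div_iff₀ hpow, mul_comm]
      exact h2
    have h6 : J ≤ (2 * D + 2) *
        ((|ξ| ^ (k + 2))⁻¹ + rexp (-(π * L)) * (1 + ξ ^ 2)⁻¹) := by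
      have h7 : 0 ≤ (|ξ| ^ (k + 2))⁻¹ := by positivity
      have h8 : 0 ≤ rexp (-(π * L)) * (1 + ξ ^ 2)⁻¹ := by positivity
      have h9 : 2 * rexp (-(π * L)) / (1 + ξ ^ 2) = 2 * (rexp (-(π * L)) * (1 + ξ ^ 2)⁻¹) := by
        ring
      rw [h9] at h3
      nlinarith
    refine hw'.trans ?_
    calc 1 / L * J ≤ _ := mul_le_mul_of_nonneg_left h6 (by positivity)
      _ = _ := by ring

theorem exists_interp_profile_sup_bounds (k : ℕ) : ∃ C : ℝ, 0 < C ∧ ∀ (L : ℝ) (N : ℕ),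
    1 ≤ π * L → 0 < N → Even N →
    (∀ p, ‖interp L N (profileNodes k L N) p‖ ≤ C) ∧
    ∀ p ∈ Set.Icc (-(π * L)) (π * L),
      ‖interp L N (profileNodes k L N) p - smoothProfile k p‖ ≤
        C * ((2 * π * L / N) ^ (k + 1) + rexp (-(π * L))) := by
  obtain ⟨D, hD0, hD⟩ := exists_norm_waveCoeff_profile_le k
  -- The largest demand is `2 · 14 D`: the factor 2 comes from the interpolation lemmas, and `14 L`
  -- bounds `6 L + 2` since `1 ≤ 4 L`.
  refine ⟨32 * D, by positivity, fun L N hL hN he => ?_⟩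
  have hL0 : 0 < L := by
    by_contra h
    nlinarith [Real.pi_pos]
  have hL1 : 1 ≤ 4 * L := by nlinarith [Real.pi_lt_four]
  set c := waveCoeff L (fun p => (smoothProfile k p : ℂ)) with hc
  have hS := summable_inv_one_add_sq hL0
  have hS1 := tsum_inv_one_add_sq_le hL0
  have hSL : ∑' n : ℤ, (1 + ((n : ℝ) / L) ^ 2)⁻¹ ≤ 14 * L := by linarith
  have hcs : Summable fun n => ‖c n‖ :=
    Summable.of_nonneg_of_le (fun _ => norm_nonneg _) (fun n => (hD L hL n).1) (hS.mul_left _)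
  have hcont := continuous_smoothProfile k
  have hend : ((smoothProfile k (-(π * L)) : ℝ) : ℂ) = (smoothProfile k (π * L) : ℝ) := by
    rw [smoothProfile_of_le_neg_one k (by linarith), smoothProfile_of_nonneg k (by linarith)]
  have hsum : ∀ p ∈ Set.Icc (-(π * L)) (π * L),
      HasSum (fun n => c n * wave L n p) ((smoothProfile k p : ℝ) : ℂ) := fun p hp =>
    hasSum_wave hL0 (f := fun p => (smoothProfile k p : ℂ)) (by fun_prop) hend hcs hp
  have hnodes : ∀ i, HasSum (fun n => c n * wave L n (pGrid L N i)) (profileNodes k L N i) :=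
    fun i => hsum _ (pGrid_mem hL0 i)
  constructor
  · intro p
    refine (norm_interp_le hL0.ne' hN he hcs hnodes p).trans ?_
    have h1 := hcs.tsum_le_tsum (fun n => (hD L hL n).1) (hS.mul_left _)
    rw [tsum_mul_left] at h1
    have h2 : D / L * ∑' n : ℤ, (1 + ((n : ℝ) / L) ^ 2)⁻¹ ≤ D / L * (14 * L) :=
      mul_le_mul_of_nonneg_left hSL (by positivity)
    have h3 : D / L * (14 * L) = 14 * D := by field_simp
    linarith
  · intro p hp
    refine (norm_interp_sub_le hL0.ne' hN he hcs hnodes (hsum p hp)).trans ?_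
    obtain ⟨A, rfl⟩ := he
    have hA : 0 < A := by omega
    have hA' : (0 : ℝ) < A := by exact_mod_cast hA
    have hset : {n : ℤ | ((A + A : ℕ) : ℤ) ≤ 2 * |n|} = {n : ℤ | (A : ℤ) ≤ |n|} := by
      ext n
      simp only [Set.mem_ofPred_eq]
      push_cast
      constructor <;> intro h <;> linarith
    rw [hset]
    -- With `N = 2A` the mesh size is `Δp = π X`.
    set X := L / A with hX
    have hX0 : 0 < X := by positivity
    have hdp : 2 * π * L / ((A + A : ℕ) : ℝ) = π * X := by
      rw [hX]
      push_cast
      field_simp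
      ring
    rw [hdp]
    have hterm : ∀ n : ℤ, {n : ℤ | (A : ℤ) ≤ |n|}.indicator (fun n => ‖c n‖) n ≤
        D / L * (X ^ k * L ^ 2) *
          {n : ℤ | (A : ℤ) ≤ |n|}.indicator (fun n : ℤ => ((n : ℝ) ^ 2)⁻¹) n +
        D / L * rexp (-(π * L)) * (1 + ((n : ℝ) / L) ^ 2)⁻¹ := by
      intro n
      by_cases hn : (A : ℤ) ≤ |n|
      · rw [Set.indicator_of_mem (by exact hn), Set.indicator_of_mem (by exact hn)]
        have hn0 : n ≠ 0 := by rintro rfl; simp at hn; omega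
        have hn0' : (n : ℝ) ≠ 0 := by exact_mod_cast hn0
        refine ((hD L hL n).2 hn0).trans ?_
        have hAn : (A : ℝ) ≤ |(n : ℝ)| := by exact_mod_cast hn
        have habs : 0 < |(n : ℝ)| := abs_pos.2 hn0'
        have h1 : (|(n : ℝ) / L| ^ (k + 2))⁻¹ ≤ X ^ k * L ^ 2 * ((n : ℝ) ^ 2)⁻¹ := by
          rw [abs_div, abs_of_pos hL0, ← inv_pow, inv_div, pow_add, div_pow L _ 2, sq_abs, hX,
            mul_assoc, ← div_eq_mul_inv]
          refine mul_le_mul_of_nonneg_right ?_ (by positivity)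
          exact pow_le_pow_left₀ (by positivity) (div_le_div_of_nonneg_left hL0.le hA' hAn) k
        calc D / L * ((|(n : ℝ) / L| ^ (k + 2))⁻¹ + rexp (-(π * L)) * (1 + ((n : ℝ) / L) ^ 2)⁻¹)
            ≤ D / L * (X ^ k * L ^ 2 * ((n : ℝ) ^ 2)⁻¹ +
              rexp (-(π * L)) * (1 + ((n : ℝ) / L) ^ 2)⁻¹) := by gcongr
          _ = _ := by ring
      · rw [Set.indicator_of_notMem (by exact hn), Set.indicator_of_notMem (by exact hn)]
        have := exp_pos (-(π * L))
        positivity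
    have hI := (summable_inv_int_sq.indicator {n : ℤ | (A : ℤ) ≤ |n|})
    have h1 := (hcs.indicator {n : ℤ | (A : ℤ) ≤ |n|}).tsum_le_tsum hterm
      ((hI.mul_left _).add (hS.mul_left _))
    rw [(hI.mul_left _).tsum_add (hS.mul_left _), tsum_mul_left, tsum_mul_left] at h1
    have h2 : D / L * (X ^ k * L ^ 2) *
        (∑' n : ℤ, {n : ℤ | (A : ℤ) ≤ |n|}.indicator (fun n : ℤ => ((n : ℝ) ^ 2)⁻¹) n) ≤
        4 * D * X ^ (k + 1) := by
      calc _ ≤ D / L * (X ^ k * L ^ 2) * (4 / A) :=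
            mul_le_mul_of_nonneg_left (tsum_indicator_inv_sq_le hA) (by positivity)
        _ = 4 * D * X ^ (k + 1) := by
            rw [pow_succ X k, show L ^ 2 = L * (A * X) by rw [hX]; field_simp]
            field_simp
    have h3 : D / L * rexp (-(π * L)) * ∑' n : ℤ, (1 + ((n : ℝ) / L) ^ 2)⁻¹ ≤
        14 * D * rexp (-(π * L)) := by
      calc _ ≤ D / L * rexp (-(π * L)) * (14 * L) :=
            mul_le_mul_of_nonneg_left hSL (by have := exp_pos (-(π * L)); positivity)
        _ = _ := by field_simp
    have h4 : X ^ (k + 1) ≤ (π * X) ^ (k + 1) :=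
      pow_le_pow_left₀ hX0.le (by nlinarith [Real.pi_gt_three]) _
    have h5 := exp_pos (-(π * L))
    have h6 : 0 ≤ D * (π * X) ^ (k + 1) := by positivity
    have h7 : D * X ^ (k + 1) ≤ D * (π * X) ^ (k + 1) := mul_le_mul_of_nonneg_left h4 hD0.le
    have h8 : 0 ≤ D * rexp (-(π * L)) := by positivity
    linarith

/-! ### Mean-square bounds for trigonometric interpolants -/

theorem integral_wave {L : ℝ} (hL : 0 < L) (n : ℤ) (a : ℝ) :
    ∫ p in a..(a + 2 * π * L), wave L n p = if n = 0 then ((2 * π * L : ℝ) : ℂ) else 0 := by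
  split_ifs with hn
  · subst hn
    simp [wave]
  · have hLc : (L : ℂ) ≠ 0 := by exact_mod_cast hL.ne'
    have hnc : (n : ℂ) ≠ 0 := by exact_mod_cast hn
    have hc : Complex.I * n / L ≠ 0 := div_ne_zero (mul_ne_zero Complex.I_ne_zero hnc) hLc
    have e : ∀ p : ℝ, wave L n p =
        Complex.exp (Complex.I * n * π) * Complex.exp (Complex.I * n / L * p) := by
      intro p
      rw [wave, ← Complex.exp_add]
      congr 1
      push_cast
      field_simp
      ring
    simp only [e]
    rw [intervalIntegral.integral_const_mul, integral_exp_mul_complex hc]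
    have e2 : Complex.exp (Complex.I * n / L * ((a + 2 * π * L : ℝ) : ℂ)) =
        Complex.exp (Complex.I * n / L * a) := by
      rw [Complex.exp_eq_exp_iff_exists_int]
      refine ⟨n, ?_⟩
      push_cast
      field_simp
    rw [e2]
    simp

theorem wave_mul_conj (L : ℝ) (m n : ℤ) (p : ℝ) :
    wave L m p * (starRingEnd ℂ) (wave L n p) = wave L (m - n) p := by
  rw [wave, wave, wave, ← Complex.exp_conj, ← Complex.exp_add]
  congr 1
  simp only [map_mul, Complex.conj_I, Complex.conj_ofReal]
  push_cast
  ring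

theorem integral_norm_sq_interp {L : ℝ} (hL : 0 < L) {N : ℕ} (he : Even N) (v : Fin N → ℂ) (a : ℝ) :
    ∫ p in a..(a + 2 * π * L), ‖interp L N v p‖ ^ 2 =
      2 * π * L * ∑ j, ‖((pMatrix L N)⁻¹ *ᵥ v) j‖ ^ 2 := by
  set c := (pMatrix L N)⁻¹ *ᵥ v with hc
  have hw := continuous_wave L
  have e : ∀ p : ℝ, ((‖interp L N v p‖ ^ 2 : ℝ) : ℂ) =
      ∑ j, ∑ i, c j * (starRingEnd ℂ) (c i) * wave L (nodeFreq N j - nodeFreq N i) p := by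
    intro p
    push_cast
    rw [← Complex.mul_conj', interp, map_sum, Finset.sum_mul_sum]
    refine Finset.sum_congr rfl fun j _ => Finset.sum_congr rfl fun i _ => ?_
    rw [map_mul, ← wave_mul_conj, pBasis_eq he, pBasis_eq he]
    ring
  have h : ((∫ p in a..(a + 2 * π * L), ‖interp L N v p‖ ^ 2 : ℝ) : ℂ) =
      ((2 * π * L * ∑ j, ‖c j‖ ^ 2 : ℝ) : ℂ) := by
    rw [← intervalIntegral.integral_ofReal]
    simp only [e]
    rw [intervalIntegral.integral_finsetSum fun j _ => by
      apply Continuous.intervalIntegrable; fun_prop]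
    have e2 : ∀ j, ∫ p in a..(a + 2 * π * L),
        ∑ i, c j * (starRingEnd ℂ) (c i) * wave L (nodeFreq N j - nodeFreq N i) p =
        (2 * π * L : ℝ) * (‖c j‖ ^ 2 : ℝ) := by
      intro j
      rw [intervalIntegral.integral_finsetSum fun i _ => by
        apply Continuous.intervalIntegrable; fun_prop]
      simp only [intervalIntegral.integral_const_mul, integral_wave hL]
      rw [Finset.sum_eq_single j]
      · rw [if_pos (sub_self _), Complex.mul_conj']
        push_cast
        ring
      · intro i _ hij
        rw [if_neg, mul_zero]
        intro h
        exact hij (nodeFreq_injective N (sub_eq_zero.1 h)).symm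
      · simp
    simp only [e2]
    push_cast
    rw [Finset.mul_sum]
  exact_mod_cast h

theorem integral_norm_sq_interp_le {L : ℝ} (hL : 0 < L) {N : ℕ} (hN : 0 < N) (he : Even N)
    {v : Fin N → ℂ} {B : ℝ} (hB : ∀ j, ‖v j‖ ≤ B) {a m : ℝ} (hm0 : 0 ≤ m)
    (hm : m ≤ 2 * π * L) : ∫ p in a..(a + m), ‖interp L N v p‖ ^ 2 ≤ 2 * π * L * B ^ 2 := by
  have hcont := continuous_interp L N v
  calc ∫ p in a..(a + m), ‖interp L N v p‖ ^ 2
      ≤ ∫ p in a..(a + 2 * π * L), ‖interp L N v p‖ ^ 2 := by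
        refine intervalIntegral.integral_mono_interval le_rfl (by linarith) (by linarith)
          (Filter.Eventually.of_forall fun p => sq_nonneg _) ?_
        apply Continuous.intervalIntegrable
        fun_prop
    _ = 2 * π * L * ((N : ℝ)⁻¹ * ∑ j, ‖v j‖ ^ 2) := by
        rw [integral_norm_sq_interp hL he, sum_norm_sq_inv_pMatrix_mulVec hL.ne' hN he]
    _ ≤ 2 * π * L * B ^ 2 := by
        refine mul_le_mul_of_nonneg_left ?_ (by positivity)
        have h : ∑ j, ‖v j‖ ^ 2 ≤ ∑ _j : Fin N, B ^ 2 :=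
          Finset.sum_le_sum fun j _ => pow_le_pow_left₀ (norm_nonneg _) (hB j) 2
        rw [Finset.sum_const, Finset.card_univ, Fintype.card_fin, nsmul_eq_mul] at h
        have hN' : (0 : ℝ) < N := by exact_mod_cast hN
        rw [inv_mul_le_iff₀ hN']
        exact h

/-- This removes the restriction `1 ≤ π L`. On a short box the sup-norm analysis is unavailable, but
`e^{-πL}` is then bounded below, so a crude mean-square bound by discrete Parseval suffices. The
shift `c` is arbitrary in the first estimate, because the interpolant is periodic and so is
controlled even outside the box. -/
theorem exists_interp_profile_integral_bounds (k : ℕ) : ∃ C : ℝ, 0 < C ∧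
    ∀ (L : ℝ) (N : ℕ) (a c m : ℝ), 0 < L → 0 < N → Even N → 0 < m → m ≤ π * L →
    (∫ p in a..(a + m), ‖interp L N (profileNodes k L N) (p - c)‖ ^ 2 ≤ C * (1 + m)) ∧
    (0 ≤ a - c → a + m - c ≤ π * L →
      ∫ p in a..(a + m), ‖interp L N (profileNodes k L N) (p - c) - smoothProfile k (p - c)‖ ^ 2 ≤
        C * (1 + m) * ((2 * π * L / N) ^ (k + 1) + rexp (-(π * L))) ^ 2) := by
  obtain ⟨C, hC0, hC⟩ := exists_interp_profile_sup_bounds k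
  obtain ⟨B, hB1, hB⟩ := exists_abs_smoothProfile_le k
  refine ⟨C ^ 2 + 6 * B ^ 2 * rexp 1 ^ 2, by positivity, ?_⟩
  intro L N a c m hL hN he hm hmL
  have hN' : (0 : ℝ) < N := by exact_mod_cast hN
  have hcg := continuous_smoothProfile k
  have hci := continuous_interp L N (profileNodes k L N)
  set θ := (2 * π * L / N) ^ (k + 1) + rexp (-(π * L)) with hθ
  have hE := exp_pos (-(π * L))
  have hE1 : 1 ≤ rexp 1 := Real.one_le_exp (by norm_num)
  have hθ1 : rexp (-(π * L)) ≤ θ := by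
    have : 0 ≤ (2 * π * L / N) ^ (k + 1) := by positivity
    linarith
  have hconst : ∀ (f : ℝ → ℝ) (K : ℝ), Continuous f → (∀ p ∈ Set.Icc a (a + m), f p ≤ K) →
      ∫ p in a..(a + m), f p ≤ K * m := by
    intro f K hf hK
    have h := intervalIntegral.integral_mono_on (μ := MeasureTheory.volume) (by linarith)
      (hf.intervalIntegrable a (a + m)) (intervalIntegrable_const (c := K)) hK
    rw [intervalIntegral.integral_const] at h
    simpa [mul_comm] using h
  have hB2 : (1 : ℝ) ≤ B ^ 2 := one_le_pow₀ hB1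
  have he2 : (1 : ℝ) ≤ rexp 1 ^ 2 := one_le_pow₀ hE1
  have hBe : B ^ 2 ≤ B ^ 2 * rexp 1 ^ 2 := by nlinarith
  rcases le_or_gt 1 (π * L) with h1 | h1
  · obtain ⟨hs1, hs2⟩ := hC L N h1 hN he
    constructor
    · refine (hconst _ (C ^ 2) (by fun_prop) fun p _ =>
        pow_le_pow_left₀ (norm_nonneg _) (hs1 _) 2).trans ?_
      nlinarith [sq_nonneg C]
    · intro ha hb
      refine (hconst _ ((C * θ) ^ 2) (by fun_prop) fun p hp =>
        pow_le_pow_left₀ (norm_nonneg _) (hs2 _ ⟨by linarith [hp.1], by linarith [hp.2]⟩) 2).trans ?_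
      rw [mul_pow]
      have h2 : C ^ 2 * m ≤ (C ^ 2 + 6 * B ^ 2 * rexp 1 ^ 2) * (1 + m) := by
        nlinarith [sq_nonneg C]
      calc C ^ 2 * θ ^ 2 * m = C ^ 2 * m * θ ^ 2 := by ring
        _ ≤ _ := mul_le_mul_of_nonneg_right h2 (sq_nonneg _)
  · have hI : ∫ p in a..(a + m), ‖interp L N (profileNodes k L N) (p - c)‖ ^ 2 ≤ 2 * B ^ 2 := by
      rw [intervalIntegral.integral_comp_sub_right
        (fun p => ‖interp L N (profileNodes k L N) p‖ ^ 2)]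
      have h2 := integral_norm_sq_interp_le hL hN he (v := profileNodes k L N) (B := B)
        (fun j => by rw [profileNodes, Complex.norm_real]; exact hB _) (a := a - c) hm.le
        (by nlinarith [mul_pos Real.pi_pos hL])
      rw [show a - c + m = a + m - c by ring] at h2
      refine h2.trans ?_
      nlinarith [sq_nonneg B]
    constructor
    · refine hI.trans ?_
      nlinarith [sq_nonneg C, mul_nonneg (sq_nonneg C) hm.le,
        mul_nonneg (mul_nonneg (sq_nonneg B) (sq_nonneg (rexp 1))) hm.le]
    · intro _ _
      have h2 : ∫ p in a..(a + m),
          ‖interp L N (profileNodes k L N) (p - c) - smoothProfile k (p - c)‖ ^ 2 ≤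
          ∫ p in a..(a + m),
            (2 * ‖interp L N (profileNodes k L N) (p - c)‖ ^ 2 + 2 * B ^ 2) := by
        refine intervalIntegral.integral_mono_on (by linarith)
          (Continuous.intervalIntegrable (by fun_prop) _ _)
          (Continuous.intervalIntegrable (by fun_prop) _ _) fun p _ => ?_
        have h3 := norm_sub_le (interp L N (profileNodes k L N) (p - c))
          (smoothProfile k (p - c) : ℂ)
        have h4 : ‖(smoothProfile k (p - c) : ℂ)‖ ≤ B := by
          rw [Complex.norm_real]; exact hB _
        have h5 := norm_nonneg (interp L N (profileNodes k L N) (p - c))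
        calc _ ≤ (‖interp L N (profileNodes k L N) (p - c)‖ + B) ^ 2 :=
              pow_le_pow_left₀ (norm_nonneg _) (by linarith) 2
          _ ≤ _ := by nlinarith [sq_nonneg (‖interp L N (profileNodes k L N) (p - c)‖ - B)]
      rw [intervalIntegral.integral_add (Continuous.intervalIntegrable (by fun_prop) _ _)
        intervalIntegrable_const, intervalIntegral.integral_const_mul,
        intervalIntegral.integral_const] at h2
      simp only [add_sub_cancel_left, smul_eq_mul] at h2
      -- For `π L < 1` the claimed error size is at least `e^{-1}`, which accounts for `rexp 1 ^ 2`
      -- in the constant.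
      have h6 : 1 ≤ rexp 1 * θ := by
        have : rexp 1 * rexp (-(π * L)) ≤ rexp 1 * θ := mul_le_mul_of_nonneg_left hθ1 (exp_pos 1).le
        rw [← Real.exp_add] at this
        exact (Real.one_le_exp (by linarith)).trans this
      have h7 : 1 ≤ rexp 1 ^ 2 * θ ^ 2 := by
        rw [← mul_pow]
        exact one_le_pow₀ h6
      have h8 : 6 * B ^ 2 ≤ 6 * B ^ 2 * (rexp 1 ^ 2 * θ ^ 2) := by nlinarith
      have h9 : 6 * B ^ 2 * (1 + m) ≤ (C ^ 2 + 6 * B ^ 2 * rexp 1 ^ 2) * (1 + m) * θ ^ 2 := by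
        have := mul_le_mul_of_nonneg_right h8 (show 0 ≤ 1 + m by linarith)
        have h10 : 0 ≤ C ^ 2 * (1 + m) * θ ^ 2 := by positivity
        linarith
      refine le_trans ?_ h9
      nlinarith

/-! ### Fourier coefficients of solutions of the heat equation -/

theorem coeff_eq_integral (f : ℝ → ℂ) (l : ℤ) :
    coeff f l = (1 / (2 * π) : ℝ) *
      ∫ x in (-π)..π, Complex.exp (-(Complex.I * ((l : ℝ) : ℂ) * x)) * f x := by
  rw [coeff, fourierCoeffOn_eq_integral, Complex.real_smul, show π - -π = 2 * π by ring]
  congr 2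
  funext p
  rw [fourier_coe_apply, smul_eq_mul]
  congr 2
  have : (π : ℂ) ≠ 0 := by exact_mod_cast Real.pi_ne_zero
  push_cast
  field_simp

theorem integral_iteratedDeriv_two {f : ℝ → ℂ} (hf : ContDiff ℝ 2 f)
    (hp : Function.Periodic f (2 * π)) (l : ℤ) :
    ∫ x in (-π)..π, Complex.exp (-(Complex.I * ((l : ℝ) : ℂ) * x)) * iteratedDeriv 2 f x =
      -((l : ℝ) ^ 2 : ℝ) *
        ∫ x in (-π)..π, Complex.exp (-(Complex.I * ((l : ℝ) : ℂ) * x)) * f x := by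
  have hd1 : ∀ x, HasDerivAt f (deriv f x) x := fun x =>
    (hf.differentiable (by norm_num) x).hasDerivAt
  have hcd : ContDiff ℝ 1 (deriv f) :=
    (contDiff_succ_iff_deriv.1 (show ContDiff ℝ (1 + 1) f by rwa [one_add_one_eq_two])).2.2
  have hd2 : ∀ x, HasDerivAt (deriv f) (iteratedDeriv 2 f x) x := fun x => by
    rw [iteratedDeriv_succ, iteratedDeriv_one]
    exact (hcd.differentiable (by norm_num) x).hasDerivAt
  have hc0 := hf.continuous
  have hc2 : Continuous (iteratedDeriv 2 f) := hf.continuous_iteratedDeriv 2 le_rfl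
  have hpd : Function.Periodic (deriv f) (2 * π) := by
    intro x
    rw [← deriv_comp_add_const]
    congr 1
    funext y
    exact hp y
  -- This primitive performs both integrations by parts at once: the first-order terms cancel,
  -- leaving `f'' + l² f`. It is periodic, so there is no boundary contribution.
  have hF : ∀ x : ℝ, HasDerivAt (fun x : ℝ => Complex.exp (-(Complex.I * ((l : ℝ) : ℂ) * x)) *
      (deriv f x + Complex.I * (l : ℝ) * f x))
      (Complex.exp (-(Complex.I * ((l : ℝ) : ℂ) * x)) * iteratedDeriv 2 f x +
        ((l : ℝ) ^ 2 : ℝ) * (Complex.exp (-(Complex.I * ((l : ℝ) : ℂ) * x)) * f x)) x := by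
    intro x
    refine ((hasDerivAt_exp_neg_I_mul l x).mul
      ((hd2 x).add ((hd1 x).const_mul (Complex.I * (l : ℝ))))).congr_deriv ?_
    simp only [Pi.add_apply]
    push_cast
    linear_combination (-(l : ℂ) ^ 2 * f x * Complex.exp (-(Complex.I * l * x))) * Complex.I_sq
  have h := intervalIntegral.integral_eq_sub_of_hasDerivAt (a := -π) (b := π) (fun x _ => hF x)
    (Continuous.intervalIntegrable (by fun_prop) _ _)
  rw [intervalIntegral.integral_add (Continuous.intervalIntegrable (by fun_prop) _ _)
    (Continuous.intervalIntegrable (by fun_prop) _ _), intervalIntegral.integral_const_mul] at h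
  have e1 : f π = f (-π) := by
    have := hp (-π)
    rwa [show -π + 2 * π = π by ring] at this
  have e2 : deriv f π = deriv f (-π) := by
    have := hpd (-π)
    rwa [show -π + 2 * π = π by ring] at this
  have e3 : Complex.exp (-(Complex.I * ((l : ℝ) : ℂ) * (π : ℝ))) =
      Complex.exp (-(Complex.I * ((l : ℝ) : ℂ) * ((-π : ℝ) : ℂ))) := by
    rw [Complex.exp_eq_exp_iff_exists_int]
    refine ⟨-l, ?_⟩
    push_cast
    ring
  rw [e1, e2, e3, sub_self] at h
  linear_combination h

theorem IsHeatSolution.continuous {T : ℝ} {u : ℝ → ℝ → ℂ} (hu : IsHeatSolution T u) {t : ℝ}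
    (ht : t ∈ Set.Icc 0 T) : Continuous (u t) := by
  rw [← continuousOn_univ]
  exact hu.continuousOn.comp (f := fun x : ℝ => (t, x)) (by fun_prop) fun x _ => ⟨ht, trivial⟩

theorem IsHeatSolution.hasDerivAt_integral {T : ℝ} {u : ℝ → ℝ → ℂ} (hu : IsHeatSolution T u)
    (l : ℤ) {t : ℝ} (ht : t ∈ Set.Ioo 0 T) :
    HasDerivAt (fun t => ∫ x in (-π)..π, Complex.exp (-(Complex.I * ((l : ℝ) : ℂ) * x)) * u t x)
      (-((l : ℝ) ^ 2 : ℝ) *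
        ∫ x in (-π)..π, Complex.exp (-(Complex.I * ((l : ℝ) : ℂ) * x)) * u t x) t := by
  rw [← integral_iteratedDeriv_two (hu.contDiff t ht) (hu.periodic t ⟨ht.1.le, ht.2.le⟩)]
  -- A compact time interval inside `(0, T)` gives the uniform bound on `u_xx` needed to
  -- differentiate under the integral.
  obtain ⟨a, b, hta, hab⟩ : ∃ a b, t ∈ Set.Ioo a b ∧ Set.Icc a b ⊆ Set.Ioo 0 T :=
    ⟨t / 2, (t + T) / 2, ⟨by linarith [ht.1], by linarith [ht.2]⟩, fun y hy =>
      ⟨by linarith [ht.1, hy.1], by linarith [ht.2, hy.2]⟩⟩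
  have hcompact : IsCompact (Set.Icc a b ×ˢ Set.Icc (-π) π) := isCompact_Icc.prod isCompact_Icc
  obtain ⟨B, hB⟩ := hcompact.exists_bound_of_continuousOn
    (hu.continuousOn_deriv_two.mono (Set.prod_mono hab (Set.subset_univ _)))
  have hcu : ∀ τ ∈ Set.Ioo a b, Continuous (u τ) := fun τ hτ =>
    (hu.contDiff τ (hab (Set.Ioo_subset_Icc_self hτ))).continuous
  have hc2 : Continuous (iteratedDeriv 2 (u t)) :=
    (hu.contDiff t ht).continuous_iteratedDeriv 2 le_rfl
  refine (intervalIntegral.hasDerivAt_integral_of_dominated_loc_of_deriv_le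
    (F := fun t x => Complex.exp (-(Complex.I * ((l : ℝ) : ℂ) * x)) * u t x)
    (F' := fun t x => Complex.exp (-(Complex.I * ((l : ℝ) : ℂ) * x)) * iteratedDeriv 2 (u t) x)
    (bound := fun _ => B) (Ioo_mem_nhds hta.1 hta.2) ?_ ?_ ?_ ?_ ?_ ?_).2
  · filter_upwards [Ioo_mem_nhds hta.1 hta.2] with τ hτ
    have := hcu τ hτ
    exact Continuous.aestronglyMeasurable (by fun_prop)
  · have := hcu t hta
    exact Continuous.intervalIntegrable (by fun_prop) _ _
  · exact Continuous.aestronglyMeasurable (by fun_prop)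
  · refine Filter.Eventually.of_forall fun x hx τ hτ => ?_
    rw [Set.uIoc_of_le (by linarith [Real.pi_pos])] at hx
    rw [norm_mul, norm_exp_neg_I_mul, one_mul]
    exact hB (τ, x) ⟨Set.Ioo_subset_Icc_self hτ, ⟨hx.1.le, hx.2⟩⟩
  · exact intervalIntegrable_const
  · refine Filter.Eventually.of_forall fun x hx τ hτ => ?_
    exact (hu.heat_eq τ (hab (Set.Ioo_subset_Icc_self hτ)) x).const_mul _

theorem IsHeatSolution.continuousOn_integral {T : ℝ} (hT : 0 < T) {u : ℝ → ℝ → ℂ}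
    (hu : IsHeatSolution T u) (l : ℤ) :
    ContinuousOn
      (fun t => ∫ x in (-π)..π, Complex.exp (-(Complex.I * ((l : ℝ) : ℂ) * x)) * u t x)
      (Set.Icc 0 T) := by
  -- Clamping time to `[0, T]` makes the integrand globally continuous.
  have h1 : Continuous fun q : ℝ × ℝ => u (Set.projIcc 0 T hT.le q.1) q.2 := by
    refine hu.continuousOn.comp_continuous
      (f := fun q : ℝ × ℝ => (((Set.projIcc 0 T hT.le q.1 : Set.Icc 0 T) : ℝ), q.2)) ?_ fun q =>
      ⟨Subtype.coe_prop _, trivial⟩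
    exact ((continuous_subtype_val.comp continuous_projIcc).comp continuous_fst).prodMk
      continuous_snd
  have h2 : Continuous fun t : ℝ => ∫ x in (-π)..π,
      Complex.exp (-(Complex.I * ((l : ℝ) : ℂ) * x)) * u (Set.projIcc 0 T hT.le t) x := by
    apply intervalIntegral.continuous_parametric_intervalIntegral_of_continuous'
    have : Continuous fun q : ℝ × ℝ => Complex.exp (-(Complex.I * ((l : ℝ) : ℂ) * q.2)) := by
      fun_prop
    exact this.mul h1
  refine h2.continuousOn.congr fun t ht => ?_
  simp only [Set.projIcc_of_mem hT.le ht]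

/-- The product of `e^{l² t}` and the coefficient of `u t` has zero derivative on `(0, T)`;
continuity on `[0, T]` carries the identity to both endpoints, where the equation is not assumed. -/
theorem IsHeatSolution.coeff_final {T : ℝ} (hT : 0 < T) {u : ℝ → ℝ → ℂ}
    (hu : IsHeatSolution T u) (l : ℤ) :
    coeff (u T) l = rexp (-((l : ℝ) ^ 2 * T)) * coeff (u 0) l := by
  have hE : ∀ t : ℝ, HasDerivAt (fun t : ℝ => ((rexp ((l : ℝ) ^ 2 * t) : ℝ) : ℂ))
      ((rexp ((l : ℝ) ^ 2 * t) * (l : ℝ) ^ 2 : ℝ) : ℂ) t := by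
    intro t
    have : HasDerivAt (fun t : ℝ => rexp ((l : ℝ) ^ 2 * t))
        (rexp ((l : ℝ) ^ 2 * t) * (l : ℝ) ^ 2) t := by
      simpa using ((hasDerivAt_id t).const_mul ((l : ℝ) ^ 2)).exp
    exact this.ofReal_comp
  have h := intervalIntegral.integral_eq_sub_of_hasDerivAt_of_le hT.le
    (f := fun t => ((rexp ((l : ℝ) ^ 2 * t) : ℝ) : ℂ) *
      ∫ x in (-π)..π, Complex.exp (-(Complex.I * ((l : ℝ) : ℂ) * x)) * u t x)
    (f' := fun _ => 0)
    (ContinuousOn.mul (by fun_prop) (hu.continuousOn_integral hT l))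
    (fun t ht => ((hE t).mul (hu.hasDerivAt_integral l ht)).congr_deriv (by push_cast; ring))
    intervalIntegrable_const
  simp only [intervalIntegral.integral_zero, mul_zero, Real.exp_zero, Complex.ofReal_one,
    one_mul] at h
  rw [coeff_eq_integral, coeff_eq_integral, ← sub_eq_zero.1 h.symm, Real.exp_neg]
  have : ((rexp ((l : ℝ) ^ 2 * T) : ℝ) : ℂ) ≠ 0 := by
    exact_mod_cast (exp_pos _).ne'
  rw [Complex.ofReal_inv]
  field_simp

/-! ### Solution of the discrete system -/

theorem inv_pxMatrix (L : ℝ) (N M : ℕ) :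
    (pxMatrix L N M)⁻¹ = (pMatrix L N)⁻¹ ⊗ₖ (pMatrix 1 M)⁻¹ := by
  rw [pxMatrix, Matrix.inv_kronecker, xMatrix_eq]

theorem inv_mul_pxMatrix {L : ℝ} (hL : L ≠ 0) {N M : ℕ} (hN : 0 < N) (hNe : Even N) (hM : 0 < M)
    (hMe : Even M) : (pxMatrix L N M)⁻¹ * pxMatrix L N M = 1 := by
  rw [inv_pxMatrix, pxMatrix, xMatrix_eq, ← Matrix.mul_kronecker_mul, inv_mul_pMatrix hL hN hNe,
    inv_mul_pMatrix one_ne_zero hM hMe, Matrix.one_kronecker_one]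

theorem kronecker_diag (L : ℝ) (N M : ℕ) : pDiag L N ⊗ₖ (xDiag M ^ 2) =
    Matrix.diagonal fun q : Fin N × Fin M => ((pFreq L N q.1 * xFreq M q.2 ^ 2 : ℝ) : ℂ) := by
  rw [pDiag, xDiag, Matrix.diagonal_pow, Matrix.diagonal_kronecker_diagonal]
  congr 1
  funext q
  simp

theorem hasDerivAt_mulVec {ι : Type*} [Fintype ι] (A : Matrix ι ι ℂ) {w : ℝ → ι → ℂ} {w' : ι → ℂ}
    {t : ℝ} (h : HasDerivAt w w' t) (q : ι) :
    HasDerivAt (fun t => (A *ᵥ w t) q) ((A *ᵥ w') q) t := by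
  simp only [Matrix.mulVec, dotProduct]
  exact HasDerivAt.fun_sum fun r _ => ((hasDerivAt_pi.1 h r).const_mul (A q r))

theorem IsDiscreteSolution.coeff_initial {g : ℝ → ℝ} {T L : ℝ} (hT : 0 < T) (hL : L ≠ 0)
    {N M : ℕ} (hN : 0 < N) (hNe : Even N) (hM : 0 < M) (hMe : Even M) {uT : ℝ → ℂ}
    {w : ℝ → Fin N × Fin M → ℂ} (hw : IsDiscreteSolution g T L N M uT w) (q : Fin N × Fin M) :
    ((pxMatrix L N M)⁻¹ *ᵥ w 0) q =
      Complex.exp (-(Complex.I * ((pFreq L N q.1 * xFreq M q.2 ^ 2 : ℝ) : ℂ) * T)) *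
        ((pxMatrix L N M)⁻¹ *ᵥ w T) q := by
  set d : ℝ := pFreq L N q.1 * xFreq M q.2 ^ 2 with hd
  have hcw : ContinuousOn w (Set.Icc 0 T) := fun t ht => (hw.ode t ht).continuousWithinAt
  have hcv : ContinuousOn (fun t => ((pxMatrix L N M)⁻¹ *ᵥ w t) q) (Set.Icc 0 T) := by
    simp only [Matrix.mulVec, dotProduct]
    refine continuousOn_finsetSum _ fun r _ => ContinuousOn.mul continuousOn_const ?_
    exact (continuous_apply r).comp_continuousOn hcw
  have hder : ∀ t ∈ Set.Ioo 0 T, HasDerivAt (fun t => ((pxMatrix L N M)⁻¹ *ᵥ w t) q)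
      (Complex.I * d * ((pxMatrix L N M)⁻¹ *ᵥ w t) q) t := by
    intro t ht
    have h := hasDerivAt_mulVec (pxMatrix L N M)⁻¹
      ((hw.ode t ⟨ht.1.le, ht.2.le⟩).hasDerivAt (Icc_mem_nhds ht.1 ht.2)) q
    refine h.congr_deriv ?_
    rw [Matrix.mulVec_mulVec, Matrix.mul_smul, ← Matrix.mul_assoc, ← Matrix.mul_assoc,
      inv_mul_pxMatrix hL hN hNe hM hMe, Matrix.one_mul, kronecker_diag, Matrix.smul_mulVec,
      ← Matrix.mulVec_mulVec, Pi.smul_apply, Matrix.mulVec_diagonal, smul_eq_mul, hd]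
    ring
  have h := intervalIntegral.integral_eq_sub_of_hasDerivAt_of_le hT.le
    (f := fun t => Complex.exp (-(Complex.I * d * t)) * ((pxMatrix L N M)⁻¹ *ᵥ w t) q)
    (f' := fun _ => 0)
    (ContinuousOn.mul (by fun_prop) hcv)
    (fun t ht => ((hasDerivAt_exp_neg_I_mul d t).mul (hder t ht)).congr_deriv (by ring))
    intervalIntegrable_const
  simp only [intervalIntegral.integral_zero, Complex.ofReal_zero, mul_zero, neg_zero,
    Complex.exp_zero, one_mul] at h
  exact (sub_eq_zero.1 h.symm).symm

/-- The discrete solution at time `0`: each spatial mode carries the interpolated profile, shifted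
by `μ_j² T`. -/
theorem IsDiscreteSolution.trigInterp_initial {g : ℝ → ℝ} {T L : ℝ} (hT : 0 < T) (hL : L ≠ 0)
    {N M : ℕ} (hN : 0 < N) (hNe : Even N) (hM : 0 < M) (hMe : Even M) {uT : ℝ → ℂ}
    {w : ℝ → Fin N × Fin M → ℂ} (hw : IsDiscreteSolution g T L N M uT w) (x p : ℝ) :
    trigInterp L N M (w 0) x p = ∑ j : Fin M,
      ((pMatrix 1 M)⁻¹ *ᵥ fun i => uT (pGrid 1 M i)) j * wave 1 (nodeFreq M j) x *
        interp L N (fun i => (g (pGrid L N i) : ℂ)) (p - (nodeFreq M j : ℝ) ^ 2 * T) := by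
  have hprod : ∀ q : Fin N × Fin M, ((pxMatrix L N M)⁻¹ *ᵥ w T) q =
      ((pMatrix L N)⁻¹ *ᵥ fun i => (g (pGrid L N i) : ℂ)) q.1 *
        ((pMatrix 1 M)⁻¹ *ᵥ fun i => uT (pGrid 1 M i)) q.2 := by
    intro q
    rw [hw.terminal, inv_pxMatrix]
    simp only [Matrix.mulVec, dotProduct, Matrix.kroneckerMap_apply, xGrid_eq]
    rw [Finset.sum_mul_sum, Fintype.sum_prod_type]
    refine Finset.sum_congr rfl fun i _ => Finset.sum_congr rfl fun j _ => ?_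
    ring
  rw [trigInterp, Fintype.sum_prod_type_right]
  refine Finset.sum_congr rfl fun j _ => ?_
  rw [interp, Finset.mul_sum]
  refine Finset.sum_congr rfl fun i _ => ?_
  rw [hw.coeff_initial hT hL hN hNe hM hMe, hprod, xBasis_eq hMe]
  -- The time evolution of a `p`-mode is exactly the phase produced by translating it by `μ_j² T`.
  have e : pBasis L N i (p - (nodeFreq M j : ℝ) ^ 2 * T) =
      Complex.exp (-(Complex.I * ((pFreq L N i * xFreq M j ^ 2 : ℝ) : ℂ) * T)) * pBasis L N i p := by
    rw [pBasis, pBasis, ← Complex.exp_add, cast_nodeFreq hMe, xFreq]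
    congr 1
    push_cast
    ring
  rw [e]
  ring

/-! ### Sobolev estimates -/

theorem coeff_eq_waveCoeff (f : ℝ → ℂ) (l : ℤ) :
    coeff f l = Complex.exp (Complex.I * l * π) * waveCoeff 1 f l :=
  fourierCoeffOn_eq_waveCoeff _ one_pos (by rw [mul_one]) (by rw [mul_one]) f l

theorem norm_coeff_eq (f : ℝ → ℂ) (l : ℤ) : ‖coeff f l‖ = ‖waveCoeff 1 f l‖ := by
  rw [coeff_eq_waveCoeff, norm_mul, ← inv_inv (Complex.exp _), ← Complex.exp_neg, norm_inv,
    norm_exp_int_mul_pi, inv_one, one_mul]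

theorem waveCoeff_eq_integral_conj (f : ℝ → ℂ) (n : ℤ) :
    waveCoeff 1 f n = (1 / (2 * π) : ℝ) * ∫ x in (-π)..π, (starRingEnd ℂ) (wave 1 n x) * f x := by
  rw [waveCoeff, mul_left_comm, ← intervalIntegral.integral_const_mul, mul_one, mul_one]
  congr 2
  funext x
  rw [← mul_assoc, wave, ← Complex.exp_conj, ← Complex.exp_add]
  congr 2
  simp only [map_mul, Complex.conj_I, Complex.conj_ofReal]
  push_cast
  ring

theorem waveCoeff_wave (m n : ℤ) : waveCoeff 1 (wave 1 m) n = if n = m then 1 else 0 := by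
  rw [waveCoeff_eq_integral_conj]
  simp only [mul_comm _ (wave 1 m _), wave_mul_conj]
  have h := integral_wave one_pos (m - n) (-π)
  rw [mul_one, show -π + 2 * π = π by ring] at h
  rw [h]
  by_cases hmn : n = m
  · rw [if_pos (by omega), if_pos hmn, ← Complex.ofReal_mul]
    norm_cast
    have := Real.pi_pos
    field_simp
  · rw [if_neg (by omega), if_neg hmn, mul_zero]

theorem waveCoeff_sub_sum {f : ℝ → ℂ} (hf : Continuous f) (M : ℕ) (a : Fin M → ℂ) (n : ℤ) :
    waveCoeff 1 (fun x => f x - ∑ j, a j * wave 1 (nodeFreq M j) x) n =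
      waveCoeff 1 f n - ∑ j, if n = nodeFreq M j then a j else 0 := by
  have hw := continuous_wave 1
  have h : ∀ j, (if n = nodeFreq M j then a j else 0) =
      a j * waveCoeff 1 (wave 1 (nodeFreq M j)) n := by
    intro j
    rw [waveCoeff_wave]
    split_ifs <;> simp
  simp only [h, waveCoeff_eq_integral_conj]
  have hc : Continuous fun x => (starRingEnd ℂ) (wave 1 n x) := Complex.continuous_conj.comp (hw n)
  simp only [mul_sub, Finset.mul_sum]
  rw [intervalIntegral.integral_sub (Continuous.intervalIntegrable (by fun_prop) _ _)
    (Continuous.intervalIntegrable (by fun_prop) _ _),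
    intervalIntegral.integral_finsetSum fun j _ => Continuous.intervalIntegrable (by fun_prop) _ _,
    mul_sub, Finset.mul_sum]
  congr 1
  refine Finset.sum_congr rfl fun j _ => ?_
  simp only [mul_left_comm _ (a j)]
  rw [intervalIntegral.integral_const_mul]
  ring

theorem hasSum_norm_sq_waveCoeff {f : ℝ → ℂ} (hf : Continuous f) :
    HasSum (fun l => ‖waveCoeff 1 f l‖ ^ 2) ((2 * π)⁻¹ * ∫ x in (-π)..π, ‖f x‖ ^ 2) := by
  have hmem : MeasureTheory.MemLp f 2 (MeasureTheory.volume.restrict (Set.Ioc (-π) π)) := by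
    obtain ⟨B, hB⟩ := isCompact_Icc.exists_bound_of_continuousOn
      (hf.continuousOn (s := Set.Icc (-π) π))
    refine MeasureTheory.MemLp.of_bound hf.aestronglyMeasurable B ?_
    filter_upwards [MeasureTheory.ae_restrict_mem measurableSet_Ioc] with x hx
    exact hB x (Set.Ioc_subset_Icc_self hx)
  have h := hasSum_sq_fourierCoeffOn (neg_lt_self Real.pi_pos) hmem
  rw [show π - -π = 2 * π by ring, smul_eq_mul] at h
  convert h using 2 with l
  rw [← norm_coeff_eq, coeff]

theorem norm_coeff_le_l2Norm {f : ℝ → ℂ} (hf : Continuous f) (l : ℤ) : ‖coeff f l‖ ≤ l2Norm f := by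
  rw [l2Norm, norm_coeff_eq]
  apply Real.le_sqrt_of_sq_le
  have h := hasSum_norm_sq_waveCoeff hf
  have h1 := h.summable.le_tsum l fun _ _ => sq_nonneg _
  rw [h.tsum_eq] at h1
  refine h1.trans (mul_le_of_le_one_left ?_ ?_)
  · exact intervalIntegral.integral_nonneg (by linarith [Real.pi_pos]) fun _ _ => sq_nonneg _
  · exact inv_le_one_of_one_le₀ (by linarith [Real.pi_gt_three])

theorem sobolevNorm_nonneg (s : ℝ) (f : ℝ → ℂ) : 0 ≤ sobolevNorm s f := Real.sqrt_nonneg _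

theorem weight_nonneg (s : ℝ) (l : ℤ) (f : ℝ → ℂ) :
    0 ≤ (1 + (l : ℝ) ^ 2) ^ s * ‖coeff f l‖ ^ 2 := by positivity

theorem two_pi_mul_tsum_eq_sobolevNorm_sq (s : ℝ) (f : ℝ → ℂ) :
    2 * π * ∑' l : ℤ, (1 + (l : ℝ) ^ 2) ^ s * ‖coeff f l‖ ^ 2 = sobolevNorm s f ^ 2 := by
  rw [sobolevNorm, Real.sq_sqrt]
  exact mul_nonneg (by positivity) (tsum_nonneg fun l => weight_nonneg s l f)

theorem mul_norm_coeff_le {s : ℝ} {f : ℝ → ℂ} (hf : MemSobolev s f) {l : ℤ} {y : ℝ}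
    (hy : y ^ 2 ≤ (1 + (l : ℝ) ^ 2) ^ s) : y * ‖coeff f l‖ ≤ sobolevNorm s f := by
  refine le_of_sq_le_sq ?_ (sobolevNorm_nonneg s f)
  rw [← two_pi_mul_tsum_eq_sobolevNorm_sq, mul_pow]
  have h1 := Summable.le_tsum hf l fun l _ => weight_nonneg s l f
  have h2 := mul_le_mul_of_nonneg_right hy (sq_nonneg ‖coeff f l‖)
  have h3 : 0 ≤ ∑' l : ℤ, (1 + (l : ℝ) ^ 2) ^ s * ‖coeff f l‖ ^ 2 :=
    tsum_nonneg fun l => weight_nonneg s l f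
  nlinarith [Real.pi_gt_three]

theorem norm_coeff_le_sobolevNorm {s : ℝ} (hs : 0 ≤ s) {f : ℝ → ℂ} (hf : MemSobolev s f) (l : ℤ) :
    ‖coeff f l‖ ≤ sobolevNorm s f := by
  have h := mul_norm_coeff_le hf (l := l) (y := 1) (by
    rw [one_pow]
    exact Real.one_le_rpow (by nlinarith [sq_nonneg (l : ℝ)]) hs)
  rwa [one_mul] at h

theorem sq_rpow_le_weight {s : ℝ} (hs : 0 ≤ s) {A : ℝ} (hA : 0 ≤ A) {l : ℤ} (hl : A ≤ |(l : ℝ)|) :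
    (A ^ s) ^ 2 ≤ (1 + (l : ℝ) ^ 2) ^ s := by
  rw [← Real.rpow_natCast, ← Real.rpow_mul hA, mul_comm, Real.rpow_mul hA, Real.rpow_natCast]
  refine Real.rpow_le_rpow (sq_nonneg _) ?_ hs
  have : A ^ 2 ≤ |(l : ℝ)| ^ 2 := pow_le_pow_left₀ hA hl 2
  rw [sq_abs] at this
  linarith

theorem sum_nodeFreq_le_tsum {f : ℤ → ℝ} (hf : Summable f) (h0 : ∀ l, 0 ≤ f l) (M : ℕ) :
    ∑ j, f (nodeFreq M j) ≤ ∑' l, f l := by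
  rw [← tsum_fintype (L := .unconditional _)]
  exact tsum_comp_le_tsum_of_inj hf h0 (nodeFreq_injective M)

/-- Truncation error of the Fourier series of `f`. -/
theorem integral_norm_sq_truncation_le {s : ℝ} (hs : 0 ≤ s) {f : ℝ → ℂ} (hc : Continuous f)
    (hf : MemSobolev s f) {M : ℕ} (hM : 0 < M) (he : Even M) :
    ∫ x in (-π)..π, ‖f x - ∑ j, waveCoeff 1 f (nodeFreq M j) * wave 1 (nodeFreq M j) x‖ ^ 2 ≤
      ((2 * π / M) ^ s * sobolevNorm s f) ^ 2 := by
  have hw := continuous_wave 1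
  set R : ℝ → ℂ := fun x => f x - ∑ j, waveCoeff 1 f (nodeFreq M j) * wave 1 (nodeFreq M j) x
    with hR
  have hRc : Continuous R := by fun_prop
  have hP := hasSum_norm_sq_waveCoeff hRc
  have hM' : (0 : ℝ) < M := by exact_mod_cast hM
  -- Every omitted frequency satisfies `|l| ≥ M/2 ≥ A`; the weaker threshold `A = 1/Δx` yields
  -- `Δx^s` with no extra constant.
  set A : ℝ := M / (2 * π) with hA
  have hA0 : 0 < A := by positivity
  have hA1 : (2 * π / M) ^ s = (A ^ s)⁻¹ := by
    rw [← Real.inv_rpow hA0.le, hA, inv_div]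
  have hAs : 0 < A ^ s := Real.rpow_pos_of_pos hA0 s
  have hterm : ∀ l : ℤ, ‖waveCoeff 1 R l‖ ^ 2 ≤
      ((A ^ s) ^ 2)⁻¹ * ((1 + (l : ℝ) ^ 2) ^ s * ‖coeff f l‖ ^ 2) := by
    intro l
    rw [hR, waveCoeff_sub_sum hc]
    by_cases hl : ∃ j, l = nodeFreq M j
    · obtain ⟨j, rfl⟩ := hl
      rw [Finset.sum_eq_single j (fun i _ hij => if_neg fun h => hij (nodeFreq_injective M h).symm)
        (by simp), if_pos rfl, sub_self, norm_zero]
      rw [zero_pow two_ne_zero]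
      exact mul_nonneg (by positivity) (weight_nonneg s (nodeFreq M j) f)
    · push Not at hl
      rw [Finset.sum_eq_zero fun j _ => if_neg (hl j), sub_zero, norm_coeff_eq,
        ← mul_assoc]
      refine le_mul_of_one_le_left (sq_nonneg _) ?_
      rw [inv_mul_eq_div, one_le_div (by positivity)]
      refine sq_rpow_le_weight hs hA0.le ?_
      have h1 : (M : ℤ) ≤ 2 * |l| := by
        by_contra h
        exact hl _ (nodeFreq_aliasIdx_of_lt hM he (not_le.1 h)).symm
      have h2 : (M : ℝ) ≤ 2 * |(l : ℝ)| := by exact_mod_cast h1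
      rw [hA, div_le_iff₀ (by positivity)]
      nlinarith [Real.pi_gt_three, abs_nonneg (l : ℝ)]
  have h1 := hP.summable.tsum_le_tsum hterm (Summable.mul_left _ hf)
  rw [hP.tsum_eq, tsum_mul_left] at h1
  have h2 : ∫ x in (-π)..π, ‖R x‖ ^ 2 ≤ ((A ^ s) ^ 2)⁻¹ * sobolevNorm s f ^ 2 := by
    rw [← two_pi_mul_tsum_eq_sobolevNorm_sq]
    rw [inv_mul_le_iff₀ (by positivity)] at h1
    linarith
  refine h2.trans (le_of_eq ?_)
  rw [hA1, mul_pow, inv_pow]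

/-! ### Smoothing by the heat flow, and sums over low and high frequencies -/

theorem exp_neg_le_inv_one_add {y : ℝ} (hy : 0 ≤ y) : rexp (-y) ≤ (1 + y)⁻¹ := by
  rw [Real.exp_neg]
  exact inv_anti₀ (by linarith) (by linarith [Real.add_one_le_exp y])

theorem summable_exp_neg_sq {T : ℝ} (hT : 0 < T) : Summable fun l : ℤ => rexp (-((l : ℝ) ^ 2 * T)) := by
  have hq : 0 < (√T)⁻¹ := inv_pos.2 (Real.sqrt_pos.2 hT)
  refine Summable.of_nonneg_of_le (fun _ => (exp_pos _).le) (fun l => ?_)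
    (summable_inv_one_add_sq hq)
  have : ((l : ℝ) / (√T)⁻¹) ^ 2 = (l : ℝ) ^ 2 * T := by
    rw [div_inv_eq_mul, mul_pow, Real.sq_sqrt hT.le]
  rw [this]
  exact exp_neg_le_inv_one_add (by positivity)

theorem IsHeatSolution.waveCoeff_final {T : ℝ} (hT : 0 < T) {u : ℝ → ℝ → ℂ}
    (hu : IsHeatSolution T u) (l : ℤ) :
    waveCoeff 1 (u T) l = rexp (-((l : ℝ) ^ 2 * T)) * waveCoeff 1 (u 0) l := by
  have h := hu.coeff_final hT l
  rw [coeff_eq_waveCoeff, coeff_eq_waveCoeff] at h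
  have := Complex.exp_ne_zero (Complex.I * l * π)
  exact mul_left_cancel₀ this (by linear_combination h)

theorem IsHeatSolution.norm_waveCoeff_final {T : ℝ} (hT : 0 < T) {u : ℝ → ℝ → ℂ}
    (hu : IsHeatSolution T u) (l : ℤ) :
    ‖waveCoeff 1 (u T) l‖ = rexp (-((l : ℝ) ^ 2 * T)) * ‖coeff (u 0) l‖ := by
  rw [hu.waveCoeff_final hT, norm_mul, Complex.norm_real, Real.norm_of_nonneg (exp_pos _).le,
    norm_coeff_eq]

theorem IsHeatSolution.summable_norm_waveCoeff_final {T : ℝ} (hT : 0 < T) {u : ℝ → ℝ → ℂ}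
    (hu : IsHeatSolution T u) {s : ℝ} (hs : 0 ≤ s) (h0 : MemSobolev s (u 0)) :
    Summable fun l => ‖waveCoeff 1 (u T) l‖ := by
  refine Summable.of_nonneg_of_le (fun _ => norm_nonneg _) (fun l => ?_)
    ((summable_exp_neg_sq hT).mul_right (sobolevNorm s (u 0)))
  rw [hu.norm_waveCoeff_final hT]
  exact mul_le_mul_of_nonneg_left (norm_coeff_le_sobolevNorm hs h0 l) (exp_pos _).le

/-- Interpolation error of `u T`, measured in the coefficients. -/
theorem IsHeatSolution.sum_norm_sub_le {T : ℝ} (hT : 0 < T) {u : ℝ → ℝ → ℂ}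
    (hu : IsHeatSolution T u) {s : ℝ} (hs : 0 ≤ s) (h0 : MemSobolev s (u 0)) {M : ℕ} (hM : 0 < M)
    (he : Even M) :
    ∑ j, ‖((pMatrix 1 M)⁻¹ *ᵥ fun i => u T (pGrid 1 M i)) j - waveCoeff 1 (u T) (nodeFreq M j)‖ ≤
      (∑' l : ℤ, rexp (-((l : ℝ) ^ 2 * T))) * ((2 * π / M) ^ s * sobolevNorm s (u 0)) := by
  have hsum := hu.summable_norm_waveCoeff_final hT hs h0
  have hTm : T ∈ Set.Icc 0 T := ⟨hT.le, le_rfl⟩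
  have hend : u T (-(π * 1)) = u T (π * 1) := by
    have := hu.periodic T hTm (-(π * 1))
    rw [← this]
    congr 1
    ring
  refine (sum_norm_sub_le_tail one_ne_zero hM he hsum fun i =>
    hasSum_wave one_pos (hu.continuous hTm).continuousOn hend hsum (pGrid_mem one_pos i)).trans ?_
  rw [← tsum_mul_right]
  refine (hsum.indicator _).tsum_le_tsum (fun l => ?_) ((summable_exp_neg_sq hT).mul_right _)
  have hM' : (0 : ℝ) < M := by exact_mod_cast hM
  set A : ℝ := M / (2 * π) with hA
  have hA0 : 0 < A := by positivity
  have hA1 : (2 * π / M) ^ s = (A ^ s)⁻¹ := by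
    rw [← Real.inv_rpow hA0.le, hA, inv_div]
  have hAs : 0 < A ^ s := Real.rpow_pos_of_pos hA0 s
  have hS := sobolevNorm_nonneg s (u 0)
  by_cases hl : (M : ℤ) ≤ 2 * |l|
  · rw [Set.indicator_of_mem (by exact hl), hu.norm_waveCoeff_final hT, hA1]
    refine mul_le_mul_of_nonneg_left ?_ (exp_pos _).le
    rw [inv_mul_eq_div, le_div_iff₀ hAs, mul_comm]
    refine mul_norm_coeff_le h0 (sq_rpow_le_weight hs hA0.le ?_)
    have h2 : (M : ℝ) ≤ 2 * |(l : ℝ)| := by exact_mod_cast hl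
    rw [hA, div_le_iff₀ (by positivity)]
    nlinarith [Real.pi_gt_three, abs_nonneg (l : ℝ)]
  · rw [Set.indicator_of_notMem (by exact hl), hA1]
    have := exp_pos (-((l : ℝ) ^ 2 * T))
    positivity

/-- Counting low frequencies smoothly: `1 ≤ (1 + η²) / (1 + n²)` when `|n| ≤ η`, and the right-hand
side is summable, uniformly in `M`. -/
theorem sum_low_le {η : ℝ} {b : ℤ → ℝ} {X : ℝ} (hX : 0 ≤ X) (hb : ∀ l, b l ≤ X) (M : ℕ) :
    ∑ j, (if |(nodeFreq M j : ℝ)| ≤ η then b (nodeFreq M j) else 0) ≤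
      (1 + η ^ 2) * (∑' l : ℤ, (1 + ((l : ℝ) / 1) ^ 2)⁻¹) * X := by
  have hs := summable_inv_one_add_sq one_pos
  calc ∑ j, (if |(nodeFreq M j : ℝ)| ≤ η then b (nodeFreq M j) else 0)
      ≤ ∑ j, (1 + η ^ 2) * (1 + ((nodeFreq M j : ℝ) / 1) ^ 2)⁻¹ * X := by
        refine Finset.sum_le_sum fun j _ => ?_
        split_ifs with h
        · refine (hb _).trans (le_mul_of_one_le_left hX ?_)
          rw [← div_eq_mul_inv, one_le_div (by positivity), div_one]
          have := pow_le_pow_left₀ (abs_nonneg _) h 2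
          rw [sq_abs] at this
          linarith
        · positivity
    _ = (1 + η ^ 2) * (∑ j, (1 + ((nodeFreq M j : ℝ) / 1) ^ 2)⁻¹) * X := by
        rw [Finset.mul_sum, Finset.sum_mul]
    _ ≤ _ := by
        refine mul_le_mul_of_nonneg_right (mul_le_mul_of_nonneg_left ?_ (by positivity)) hX
        exact sum_nodeFreq_le_tsum hs (fun l => by positivity) M

/-- Cauchy–Schwarz with the weight `1 + n²`, which is summable when inverted and is dominated by `(1
+ n²)^s` because `s ≥ 1`. The `1 + S` simply replaces `√S`. -/
theorem sum_high_le {s η : ℝ} (hs : 1 ≤ s) {f : ℝ → ℂ} (hf : MemSobolev s f) (M : ℕ) :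
    ∑ j, (if |(nodeFreq M j : ℝ)| ≤ η then 0 else ‖coeff f (nodeFreq M j)‖) ≤
      (1 + ∑' l : ℤ, (1 + ((l : ℝ) / 1) ^ 2)⁻¹) * sobolevTail s η f := by
  have hsum := summable_inv_one_add_sq one_pos
  set S := ∑' l : ℤ, (1 + ((l : ℝ) / 1) ^ 2)⁻¹ with hS
  have hS0 : 0 ≤ S := tsum_nonneg fun l => by positivity
  set W : ℤ → ℝ := fun l => (1 + (l : ℝ) ^ 2) ^ s * ‖coeff f l‖ ^ 2 with hW
  have hW0 : ∀ l, 0 ≤ W l := fun l => weight_nonneg s l f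
  have htail : sobolevTail s η f ^ 2 =
      2 * π * ∑' l : ℤ, {l : ℤ | η < |(l : ℝ)|}.indicator W l := by
    rw [sobolevTail, Real.sq_sqrt (mul_nonneg (by positivity)
      (tsum_nonneg fun l : {l : ℤ // η < |(l : ℝ)|} => hW0 l))]
    congr 1
    exact tsum_subtype {l : ℤ | η < |(l : ℝ)|} W
  have hδ0 : 0 ≤ sobolevTail s η f := Real.sqrt_nonneg _
  refine le_of_sq_le_sq ?_ (by positivity)
  have h1 : (∑ j, (if |(nodeFreq M j : ℝ)| ≤ η then 0 else ‖coeff f (nodeFreq M j)‖)) ^ 2 ≤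
      (∑ j, (1 + ((nodeFreq M j : ℝ) / 1) ^ 2)⁻¹) *
      ∑ j, (if |(nodeFreq M j : ℝ)| ≤ η then 0 else
        (1 + (nodeFreq M j : ℝ) ^ 2) * ‖coeff f (nodeFreq M j)‖ ^ 2) := by
    refine Finset.sum_sq_le_sum_mul_sum_of_sq_le_mul _ (fun j _ => by positivity)
      (fun j _ => by split_ifs <;> positivity) fun j _ => ?_
    split_ifs
    · simp
    · have : (1 + (nodeFreq M j : ℝ) ^ 2) ≠ 0 := by positivity
      rw [div_one]
      apply le_of_eq
      field_simp
  have h2 : ∑ j, (if |(nodeFreq M j : ℝ)| ≤ η then 0 else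
        (1 + (nodeFreq M j : ℝ) ^ 2) * ‖coeff f (nodeFreq M j)‖ ^ 2) ≤
      ∑' l : ℤ, {l : ℤ | η < |(l : ℝ)|}.indicator W l := by
    refine le_trans (Finset.sum_le_sum fun j _ => ?_) (sum_nodeFreq_le_tsum
      (Summable.indicator hf _) (fun l => Set.indicator_nonneg (fun l _ => hW0 l) l) M)
    split_ifs with h
    · exact Set.indicator_nonneg (fun l _ => hW0 l) _
    · rw [Set.indicator_of_mem (by exact not_le.1 h)]
      refine mul_le_mul_of_nonneg_right ?_ (sq_nonneg _)
      exact Real.self_le_rpow_of_one_le (by nlinarith [sq_nonneg (nodeFreq M j : ℝ)]) hs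
  have h3 := sum_nodeFreq_le_tsum hsum (fun l => by positivity) M
  have h4 : 0 ≤ ∑' l : ℤ, {l : ℤ | η < |(l : ℝ)|}.indicator W l :=
    tsum_nonneg fun l => Set.indicator_nonneg (fun l _ => hW0 l) l
  calc _ ≤ _ := h1
    _ ≤ S * ∑' l : ℤ, {l : ℤ | η < |(l : ℝ)|}.indicator W l :=
        mul_le_mul h3 h2 (Finset.sum_nonneg fun j _ => by split_ifs <;> positivity) hS0
    _ ≤ (1 + S) ^ 2 * sobolevTail s η f ^ 2 := by
        rw [htail]
        have h5 : S ≤ (1 + S) ^ 2 := by nlinarith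
        exact mul_le_mul h5 (le_mul_of_one_le_left h4 (by linarith [Real.pi_gt_three])) h4
          (sq_nonneg _)
    _ = _ := by rw [mul_pow]

/-- Cauchy–Schwarz with the weights `b j`. The bound `K` is required only where `b j ≠ 0`, since the
profile error is controlled for low frequencies only. -/
theorem integral_sq_sum_le {ι : Type*} [Fintype ι] {b : ι → ℝ} (hb : ∀ j, 0 ≤ b j) {h : ι → ℝ → ℝ}
    (hc : ∀ j, Continuous (h j)) {a m K : ℝ} (hm : 0 ≤ m)
    (hK : ∀ j, b j ≠ 0 → ∫ p in a..(a + m), h j p ^ 2 ≤ K) :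
    ∫ p in a..(a + m), (∑ j, b j * h j p) ^ 2 ≤ (∑ j, b j) ^ 2 * K := by
  calc ∫ p in a..(a + m), (∑ j, b j * h j p) ^ 2
      ≤ ∫ p in a..(a + m), (∑ j, b j) * ∑ j, b j * h j p ^ 2 := by
        refine intervalIntegral.integral_mono_on (by linarith)
          (Continuous.intervalIntegrable (by fun_prop) _ _)
          (Continuous.intervalIntegrable (by fun_prop) _ _) fun p _ => ?_
        exact Finset.sum_sq_le_sum_mul_sum_of_sq_le_mul _ (fun j _ => hb j)
          (fun j _ => mul_nonneg (hb j) (sq_nonneg _)) fun j _ => le_of_eq (by ring)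
    _ = (∑ j, b j) * ∑ j, b j * ∫ p in a..(a + m), h j p ^ 2 := by
        rw [intervalIntegral.integral_const_mul, intervalIntegral.integral_finsetSum fun j _ =>
          Continuous.intervalIntegrable (by fun_prop) _ _]
        simp only [intervalIntegral.integral_const_mul]
    _ ≤ (∑ j, b j) * ∑ j, b j * K := by
        refine mul_le_mul_of_nonneg_left (Finset.sum_le_sum fun j _ => ?_)
          (Finset.sum_nonneg fun j _ => hb j)
        by_cases h0 : b j = 0
        · simp [h0]
        · exact mul_le_mul_of_nonneg_left (hK j h0) (hb j)
    _ = _ := by rw [← Finset.sum_mul]; ring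

/-! ### The error estimate -/

theorem integral_integral_sq_le {E : ℝ → ℝ → ℂ} {R : ℝ → ℂ} {Ψ : ℝ → ℝ} {a m : ℝ} (hm : 0 ≤ m)
    (hEc : Continuous fun q : ℝ × ℝ => E q.2 q.1) (hR : Continuous R) (hΨ : Continuous Ψ)
    (hE : ∀ p ∈ Set.Icc a (a + m), ∀ x, ‖E x p‖ ≤ ‖R x‖ + Ψ p) :
    ∫ p in a..(a + m), ∫ x in (-π)..π, ‖E x p‖ ^ 2 ≤
      2 * m * (∫ x in (-π)..π, ‖R x‖ ^ 2) + 4 * π * ∫ p in a..(a + m), Ψ p ^ 2 := by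
  have hinner : Continuous fun p => ∫ x in (-π)..π, ‖E x p‖ ^ 2 :=
    intervalIntegral.continuous_parametric_intervalIntegral_of_continuous'
      (f := fun p x => ‖E x p‖ ^ 2)
      (show Continuous fun q : ℝ × ℝ => ‖E q.2 q.1‖ ^ 2 from hEc.norm.pow 2) _ _
  have h1 : ∀ p ∈ Set.Icc a (a + m), ∫ x in (-π)..π, ‖E x p‖ ^ 2 ≤
      2 * (∫ x in (-π)..π, ‖R x‖ ^ 2) + 4 * π * Ψ p ^ 2 := by
    intro p hp
    have hEp : Continuous fun x => E x p :=
      hEc.comp (f := fun x : ℝ => (p, x)) (by fun_prop)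
    have h2 : ∫ x in (-π)..π, ‖E x p‖ ^ 2 ≤
        ∫ x in (-π)..π, (2 * ‖R x‖ ^ 2 + 2 * Ψ p ^ 2) := by
      refine intervalIntegral.integral_mono_on (by linarith [Real.pi_pos])
        (Continuous.intervalIntegrable (by fun_prop) _ _)
        (Continuous.intervalIntegrable (by fun_prop) _ _) fun x _ => ?_
      have h3 := pow_le_pow_left₀ (norm_nonneg _) (hE p hp x) 2
      nlinarith [sq_nonneg (‖R x‖ - Ψ p)]
    rw [intervalIntegral.integral_add (Continuous.intervalIntegrable (by fun_prop) _ _)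
      intervalIntegrable_const, intervalIntegral.integral_const_mul,
      intervalIntegral.integral_const, smul_eq_mul] at h2
    linarith
  have h2 := intervalIntegral.integral_mono_on (μ := MeasureTheory.volume) (by linarith)
    (hinner.intervalIntegrable a (a + m))
    (Continuous.intervalIntegrable (by fun_prop) _ _) h1
  rw [intervalIntegral.integral_add intervalIntegrable_const
    (Continuous.intervalIntegrable (by fun_prop) _ _), intervalIntegral.integral_const, smul_eq_mul,
    intervalIntegral.integral_const_mul (4 * π)] at h2
  linarith

/-- Error of a single mode of frequency `n` at most `η`. -/
theorem norm_low_mode_le (k : ℕ) {n : ℤ} {T η Q p : ℝ} (hT : 0 < T) (hn : |(n : ℝ)| ≤ η)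
    (hp : η ^ 2 * T ≤ p) (hQ : rexp p ≤ Q) {a b : ℂ} (hb : b = rexp (-((n : ℝ) ^ 2 * T)) * a)
    (c y : ℂ) :
    ‖a - rexp p * (c * y)‖ ≤
      Q * (‖c - b‖ * ‖y‖ + ‖b‖ * ‖y - smoothProfile k (p - (n : ℝ) ^ 2 * T)‖) := by
  have hn2 : (n : ℝ) ^ 2 ≤ η ^ 2 := by
    rw [← sq_abs]
    exact pow_le_pow_left₀ (abs_nonneg _) hn 2
  have hpos : 0 ≤ p - (n : ℝ) ^ 2 * T := by nlinarith
  -- Exact recovery: the shifted argument is nonnegative, so the profile is `e^{-p + n² T}` and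
  -- undoes both `e^p` and the heat decay.
  have ha : a = rexp p * (b * smoothProfile k (p - (n : ℝ) ^ 2 * T)) := by
    rw [smoothProfile_of_nonneg k hpos, hb]
    push_cast
    rw [← mul_assoc, ← mul_assoc, ← Complex.exp_add, mul_right_comm, ← Complex.exp_add]
    rw [show (p : ℂ) + -((n : ℂ) ^ 2 * T) + -(p - (n : ℂ) ^ 2 * T) = 0 by ring, Complex.exp_zero,
      one_mul]
  have e : a - rexp p * (c * y) = -(rexp p * ((c - b) * y +
      b * (y - smoothProfile k (p - (n : ℝ) ^ 2 * T)))) := by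
    linear_combination ha
  rw [e, norm_neg, norm_mul, Complex.norm_real, Real.norm_of_nonneg (exp_pos _).le]
  refine mul_le_mul hQ ((norm_add_le _ _).trans ?_) (norm_nonneg _) ((exp_pos _).le.trans hQ)
  rw [norm_mul, norm_mul]

/-- No cancellation is available here, so the true coefficient and the computed one are bounded
separately; the heat decay gives `‖b‖ ≤ ‖a‖`. -/
theorem norm_high_mode_le {n : ℤ} {T Q p : ℝ} (hT : 0 < T) (hQ : rexp p ≤ Q) {a b : ℂ}
    (hb : b = rexp (-((n : ℝ) ^ 2 * T)) * a) (c y : ℂ) :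
    ‖a - rexp p * (c * y)‖ ≤ ‖a‖ + Q * ((‖c - b‖ + ‖a‖) * ‖y‖) := by
  have hba : ‖b‖ ≤ ‖a‖ := by
    rw [hb, norm_mul, Complex.norm_real, Real.norm_of_nonneg (exp_pos _).le]
    refine mul_le_of_le_one_left (norm_nonneg _) (Real.exp_le_one_iff.2 ?_)
    have : 0 ≤ (n : ℝ) ^ 2 * T := by positivity
    linarith
  have hc : ‖c‖ ≤ ‖c - b‖ + ‖a‖ := by
    have := norm_add_le (c - b) b
    rw [sub_add_cancel] at this
    linarith
  refine (norm_sub_le _ _).trans (add_le_add le_rfl ?_)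
  rw [norm_mul, norm_mul, Complex.norm_real, Real.norm_of_nonneg (exp_pos _).le]
  exact mul_le_mul hQ (mul_le_mul_of_nonneg_right hc (norm_nonneg _)) (by positivity)
    ((exp_pos _).le.trans hQ)

/-- The four sources of error, with their sizes kept abstract: `β₁` is aliasing of `u_T`, `β₂` the
low coefficients of `u_T`, `β₃` the high coefficients of `u_0`, while `K₁` and `K₂` bound the
profile interpolant and its error in mean square. -/
theorem recovered_error_le (k : ℕ) {s T η Q L m : ℝ} (hs : 0 ≤ s) (hT : 0 < T) (hL : 0 < L)
    {N M : ℕ} (hN : 0 < N) (hNe : Even N) (hM : 0 < M) (hMe : Even M) {u : ℝ → ℝ → ℂ}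
    {w : ℝ → Fin N × Fin M → ℂ} (hu : IsHeatSolution T u) (h0 : MemSobolev s (u 0)) (hm : 0 < m)
    (hmL : m ≤ π * L - η ^ 2 * T) (hQ : rexp (η ^ 2 * T + m) ≤ Q)
    (hw : IsDiscreteSolution (smoothProfile k) T L N M (u T) w) {K₁ K₂ β₁ β₂ β₃ : ℝ}
    (hK₁ : ∀ c, ∫ p in (η ^ 2 * T)..(η ^ 2 * T + m),
      ‖interp L N (profileNodes k L N) (p - c)‖ ^ 2 ≤ K₁)
    (hK₂ : ∀ c, c ≤ η ^ 2 * T → η ^ 2 * T + m - c ≤ π * L →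
      ∫ p in (η ^ 2 * T)..(η ^ 2 * T + m),
        ‖interp L N (profileNodes k L N) (p - c) - smoothProfile k (p - c)‖ ^ 2 ≤ K₂)
    (hβ₁ : ∑ j, ‖((pMatrix 1 M)⁻¹ *ᵥ fun i => u T (pGrid 1 M i)) j -
      waveCoeff 1 (u T) (nodeFreq M j)‖ ≤ β₁)
    (hβ₂ : ∑ j, (if |(nodeFreq M j : ℝ)| ≤ η then ‖waveCoeff 1 (u T) (nodeFreq M j)‖ else 0) ≤ β₂)
    (hβ₃ : ∑ j, (if |(nodeFreq M j : ℝ)| ≤ η then 0 else ‖coeff (u 0) (nodeFreq M j)‖) ≤ β₃) :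
    ∫ p in (η ^ 2 * T)..(η ^ 2 * T + m), ∫ x in (-π)..π, ‖u 0 x - recovered L N M w x p‖ ^ 2 ≤
      2 * m * ((2 * π / M) ^ s * sobolevNorm s (u 0)) ^ 2 +
        12 * π * (m * β₃ ^ 2 + Q ^ 2 * ((β₁ + β₃) ^ 2 * K₁ + β₂ ^ 2 * K₂)) := by
  have hu0 := hu.continuous ⟨le_rfl, hT.le⟩
  set a := η ^ 2 * T with ha
  set c : Fin M → ℂ := (pMatrix 1 M)⁻¹ *ᵥ fun i => u T (pGrid 1 M i) with hc
  set G : ℝ → ℂ := interp L N (profileNodes k L N) with hG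
  have hGc : Continuous G := continuous_interp _ _ _
  have hgc := continuous_smoothProfile k
  have hwc := continuous_wave 1
  let d : Fin M → ℝ := fun j => (nodeFreq M j : ℝ) ^ 2 * T
  let b₁ : Fin M → ℝ := fun j => ‖c j - waveCoeff 1 (u T) (nodeFreq M j)‖
  let b₂ : Fin M → ℝ := fun j =>
    if |(nodeFreq M j : ℝ)| ≤ η then ‖waveCoeff 1 (u T) (nodeFreq M j)‖ else 0
  let b₃ : Fin M → ℝ := fun j =>
    if |(nodeFreq M j : ℝ)| ≤ η then 0 else ‖coeff (u 0) (nodeFreq M j)‖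
  have hb₁ : ∀ j, 0 ≤ b₁ j := fun j => norm_nonneg _
  have hb₂ : ∀ j, 0 ≤ b₂ j := fun j => by simp only [b₂]; split_ifs <;> positivity
  have hb₃ : ∀ j, 0 ≤ b₃ j := fun j => by simp only [b₃]; split_ifs <;> positivity
  -- Aliasing and high modes both multiply the size of `G`; only the low modes, in `F₂`, see the
  -- difference `G - g`.
  let F₁ : ℝ → ℝ := fun p => ∑ j, (b₁ j + b₃ j) * ‖G (p - d j)‖
  let F₂ : ℝ → ℝ := fun p => ∑ j, b₂ j * ‖G (p - d j) - smoothProfile k (p - d j)‖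
  let R : ℝ → ℂ := fun x => u 0 x - ∑ j, waveCoeff 1 (u 0) (nodeFreq M j) * wave 1 (nodeFreq M j) x
  have hF₁c : Continuous F₁ := by fun_prop
  have hF₂c : Continuous F₂ := by fun_prop
  have hQ0 : 0 ≤ Q := (exp_pos _).le.trans hQ
  have hrec : ∀ x p, recovered L N M w x p =
      rexp p * ∑ j, c j * wave 1 (nodeFreq M j) x * G (p - d j) := by
    intro x p
    rw [recovered, hw.trigInterp_initial hT hL.ne' hN hNe hM hMe]
    rfl
  have hpt : ∀ p ∈ Set.Icc a (a + m), ∀ x, ‖u 0 x - recovered L N M w x p‖ ≤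
      ‖R x‖ + ((∑ j, b₃ j) + Q * F₁ p + Q * F₂ p) := by
    intro p hp x
    have e : u 0 x - recovered L N M w x p = R x + ∑ j, wave 1 (nodeFreq M j) x *
        (waveCoeff 1 (u 0) (nodeFreq M j) - rexp p * (c j * G (p - d j))) := by
      rw [hrec]
      simp only [R, mul_sub, Finset.sum_sub_distrib, Finset.mul_sum]
      rw [Finset.sum_congr rfl fun j _ => mul_comm (wave 1 (nodeFreq M j) x)
        (waveCoeff 1 (u 0) (nodeFreq M j)), ← add_sub_assoc, sub_add_cancel]
      congr 1
      refine Finset.sum_congr rfl fun j _ => ?_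
      ring
    rw [e]
    refine (norm_add_le _ _).trans (add_le_add le_rfl ((norm_sum_le _ _).trans ?_))
    simp only [F₁, F₂]
    rw [Finset.mul_sum, Finset.mul_sum, ← Finset.sum_add_distrib, ← Finset.sum_add_distrib]
    refine Finset.sum_le_sum fun j _ => ?_
    rw [norm_mul, norm_wave, one_mul]
    have hQp : rexp p ≤ Q := (Real.exp_le_exp.2 hp.2).trans hQ
    have hb := hu.waveCoeff_final hT (nodeFreq M j)
    simp only [b₁, b₂, b₃]
    split_ifs with hj
    · refine (norm_low_mode_le k hT hj hp.1 hQp hb (c j) (G (p - d j))).trans (le_of_eq ?_)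
      simp only [d]
      ring
    · refine (norm_high_mode_le hT hQp hb (c j) (G (p - d j))).trans (le_of_eq ?_)
      rw [norm_coeff_eq]
      ring
  have hI₁ : ∫ p in a..(a + m), F₁ p ^ 2 ≤ (β₁ + β₃) ^ 2 * K₁ := by
    have hK0 : 0 ≤ K₁ := (intervalIntegral.integral_nonneg (by linarith)
      fun _ _ => sq_nonneg _).trans (hK₁ 0)
    refine (integral_sq_sum_le (fun j => add_nonneg (hb₁ j) (hb₃ j)) (fun j => by fun_prop) hm.le
      fun j _ => hK₁ (d j)).trans ?_
    refine mul_le_mul_of_nonneg_right ?_ hK0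
    rw [Finset.sum_add_distrib]
    exact pow_le_pow_left₀ (add_nonneg (Finset.sum_nonneg fun j _ => hb₁ j)
      (Finset.sum_nonneg fun j _ => hb₃ j)) (add_le_add hβ₁ hβ₃) 2
  have hI₂ : ∫ p in a..(a + m), F₂ p ^ 2 ≤ β₂ ^ 2 * K₂ := by
    have hK0 : 0 ≤ K₂ := (intervalIntegral.integral_nonneg (by linarith)
      fun _ _ => sq_nonneg _).trans (hK₂ a le_rfl (by rw [ha] at *; nlinarith [sq_nonneg η]))
    refine (integral_sq_sum_le (K := K₂) hb₂ (fun j => by fun_prop) hm.le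
      fun j hj => ?_).trans ?_
    · have hle : |(nodeFreq M j : ℝ)| ≤ η := by
        by_contra h
        exact hj (by simp only [b₂]; rw [if_neg h])
      refine hK₂ (d j) ?_ ?_
      · have := pow_le_pow_left₀ (abs_nonneg _) hle 2
        rw [sq_abs] at this
        exact mul_le_mul_of_nonneg_right this hT.le
      · have : 0 ≤ d j := by positivity
        linarith
    · exact mul_le_mul_of_nonneg_right
        (pow_le_pow_left₀ (Finset.sum_nonneg fun j _ => hb₂ j) hβ₂ 2) hK0
  have hb₃β : (∑ j, b₃ j) ^ 2 ≤ β₃ ^ 2 :=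
    pow_le_pow_left₀ (Finset.sum_nonneg fun j _ => hb₃ j) hβ₃ 2
  have hΨ : ∫ p in a..(a + m), ((∑ j, b₃ j) + Q * F₁ p + Q * F₂ p) ^ 2 ≤
      3 * (m * β₃ ^ 2 + Q ^ 2 * ((β₁ + β₃) ^ 2 * K₁ + β₂ ^ 2 * K₂)) := by
    have h1 : ∫ p in a..(a + m), ((∑ j, b₃ j) + Q * F₁ p + Q * F₂ p) ^ 2 ≤
        ∫ p in a..(a + m), (3 * β₃ ^ 2 + 3 * Q ^ 2 * F₁ p ^ 2 + 3 * Q ^ 2 * F₂ p ^ 2) := by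
      refine intervalIntegral.integral_mono_on (by linarith)
        (Continuous.intervalIntegrable (by fun_prop) _ _)
        (Continuous.intervalIntegrable (by fun_prop) _ _) fun p _ => ?_
      nlinarith [sq_nonneg ((∑ j, b₃ j) - Q * F₁ p), sq_nonneg ((∑ j, b₃ j) - Q * F₂ p),
        sq_nonneg (Q * F₁ p - Q * F₂ p)]
    rw [intervalIntegral.integral_add (Continuous.intervalIntegrable (by fun_prop) _ _)
      (Continuous.intervalIntegrable (by fun_prop) _ _),
      intervalIntegral.integral_add intervalIntegrable_const
      (Continuous.intervalIntegrable (by fun_prop) _ _), intervalIntegral.integral_const,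
      smul_eq_mul] at h1
    simp only [intervalIntegral.integral_const_mul (3 * Q ^ 2)] at h1
    have h2 := mul_le_mul_of_nonneg_left hI₁ (sq_nonneg Q)
    have h3 := mul_le_mul_of_nonneg_left hI₂ (sq_nonneg Q)
    linarith
  have hEc : Continuous fun q : ℝ × ℝ => u 0 q.2 - recovered L N M w q.2 q.1 := by
    simp only [hrec]
    fun_prop
  have hRc : Continuous R := by fun_prop
  have hfin := integral_integral_sq_le (E := fun x p => u 0 x - recovered L N M w x p) hm.le hEc hRc
    (show Continuous fun p => (∑ j, b₃ j) + Q * F₁ p + Q * F₂ p by fun_prop) hpt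
  have hRb := integral_norm_sq_truncation_le hs hu0 h0 hM hMe
  have h1 := mul_le_mul_of_nonneg_left hRb (show 0 ≤ 2 * m by linarith)
  have h2 := mul_le_mul_of_nonneg_left hΨ (show 0 ≤ 4 * π by positivity)
  refine hfin.trans ?_
  linarith

/-- Every error size is a fixed multiple of `Y`, so `I ≤ E Y²`; the root is taken with `E ≤ (1 +
E)²`. The product `β₂ * θ` is bounded as a whole, because the two parts of `θ` are paid by different
norms. -/
theorem combine_error_bounds {I b m Q C E κ₁ κ₂ κ₃ Y β₁ β₂ β₃ θ X : ℝ} (hb : 0 ≤ b)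
    (hmb : m ≤ b) (hC : 0 ≤ C) (hE : 0 ≤ E) (hθ : 0 ≤ θ) (hX : 0 ≤ X) (hXY : X ≤ Y)
    (hβ₁ : 0 ≤ β₁) (hβ₂ : 0 ≤ β₂) (hβ₃ : 0 ≤ β₃)
    (h₁ : β₁ + β₃ ≤ κ₁ * Y) (h₂ : β₂ * θ ≤ κ₂ * Y) (h₃ : β₃ ≤ κ₃ * Y)
    (hE' : E = 2 * b + 12 * π * (b * κ₃ ^ 2 + Q ^ 2 * (κ₁ ^ 2 * C + κ₂ ^ 2 * C)))
    (hI : I ≤ 2 * m * X ^ 2 +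
      12 * π * (m * β₃ ^ 2 + Q ^ 2 * ((β₁ + β₃) ^ 2 * C + β₂ ^ 2 * (C * θ ^ 2)))) :
    √I ≤ (1 + E) * Y := by
  have hY : 0 ≤ Y := hX.trans hXY
  have t0 : 2 * m * X ^ 2 ≤ 2 * b * Y ^ 2 :=
    mul_le_mul (by linarith) (pow_le_pow_left₀ hX hXY 2) (sq_nonneg _) (by positivity)
  have t3 : m * β₃ ^ 2 ≤ b * (κ₃ * Y) ^ 2 :=
    mul_le_mul hmb (pow_le_pow_left₀ hβ₃ h₃ 2) (sq_nonneg _) hb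
  have t1 : (β₁ + β₃) ^ 2 * C ≤ (κ₁ * Y) ^ 2 * C :=
    mul_le_mul_of_nonneg_right (pow_le_pow_left₀ (by positivity) h₁ 2) hC
  have t2 : β₂ ^ 2 * (C * θ ^ 2) ≤ (κ₂ * Y) ^ 2 * C := by
    have h := mul_le_mul_of_nonneg_right
      (pow_le_pow_left₀ (show 0 ≤ β₂ * θ by positivity) h₂ 2) hC
    linarith
  have t4 := mul_le_mul_of_nonneg_left (add_le_add t3
    (mul_le_mul_of_nonneg_left (add_le_add t1 t2) (sq_nonneg Q))) (show 0 ≤ 12 * π by positivity)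
  refine Real.sqrt_le_iff.2 ⟨by positivity, hI.trans ((add_le_add t0 t4).trans ?_)⟩
  have e : 2 * b * Y ^ 2 + 12 * π * (b * (κ₃ * Y) ^ 2 + Q ^ 2 *
      ((κ₁ * Y) ^ 2 * C + (κ₂ * Y) ^ 2 * C)) = E * Y ^ 2 := by
    rw [hE']
    ring
  rw [e, mul_pow]
  exact mul_le_mul_of_nonneg_right (by nlinarith) (sq_nonneg Y)

end SmoothInit

/-! ### Choice of constants and the final estimate -/

theorem mainTheorem6 (k : ℕ) :
    ContDiff ℝ k (SmoothInit.smoothProfile k) ∧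
    ∀ s T ηmax K : ℝ, 1 ≤ s → 0 < T → 0 < ηmax → 0 < K →
      ∃ C : ℝ, 0 < C ∧
        ∀ (L m ε : ℝ) (N M : ℕ) (u : ℝ → ℝ → ℂ) (w : ℝ → Fin N × Fin M → ℂ),
          0 < L → 0 < N → Even N → 0 < M → Even M → 0 < ε →
          SmoothInit.IsHeatSolution T u →
          SmoothInit.MemSobolev s (u 0) →
          (SmoothInit.sobolevTail s ηmax (u 0) / ε) ^ (1 / s) ≤ ηmax →
          Real.exp (-(Real.pi * L - 4.5 * ηmax ^ 2 * T)) * SmoothInit.l2Norm (u T) ≤ K * ε →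
          0 < m → m ≤ min (Real.pi * L - ηmax ^ 2 * T) (1 / 2 * (ηmax ^ 2 * T)) →
          SmoothInit.IsDiscreteSolution (SmoothInit.smoothProfile k) T L N M (u T) w →
          SmoothInit.recoveryError (u 0) (SmoothInit.recovered L N M w) (ηmax ^ 2 * T) m ≤
            C * (((2 * Real.pi * L / N) ^ (k + 1) + (2 * Real.pi / M) ^ s) *
              SmoothInit.sobolevNorm s (u 0) + ε) := by
  refine ⟨SmoothInit.contDiff_smoothProfile k, fun s T η K hs hT hη hK => ?_⟩
  obtain ⟨C₁, hC₁, hI⟩ := SmoothInit.exists_interp_profile_integral_bounds k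
  set S := ∑' l : ℤ, (1 + ((l : ℝ) / 1) ^ 2)⁻¹ with hS
  set E := ∑' l : ℤ, rexp (-((l : ℝ) ^ 2 * T)) with hE
  have hS0 : 0 ≤ S := tsum_nonneg fun l => by positivity
  have hE0 : 0 ≤ E := tsum_nonneg fun l => (exp_pos _).le
  have hs0 : 0 < s := by linarith
  have hηs : 0 < η ^ s := Real.rpow_pos_of_pos hη s
  -- `b` is the largest admissible window length, so `Q` bounds `e^p` on every window.
  set b := 1 / 2 * (η ^ 2 * T) with hb
  have hb0 : 0 < b := by positivity
  set Q := rexp (η ^ 2 * T + b) with hQ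
  set κ₁ := E + (1 + S) * η ^ s with hκ₁
  set κ₂ := (1 + η ^ 2) * S * (1 + K) with hκ₂
  set κ₃ := (1 + S) * η ^ s with hκ₃
  have hκ₁0 : 0 ≤ κ₁ := by positivity
  have hκ₂0 : 0 ≤ κ₂ := by positivity
  have hκ₃0 : 0 ≤ κ₃ := by positivity
  set V := 2 * b + 12 * π * (b * κ₃ ^ 2 + Q ^ 2 * (κ₁ ^ 2 * (C₁ * (1 + b)) +
    κ₂ ^ 2 * (C₁ * (1 + b)))) with hV
  have hV0 : 0 ≤ V := by positivity
  refine ⟨1 + V, by positivity, ?_⟩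
  intro L m ε N M u w hL hN hNe hM hMe hε hu h0 hδ hK' hm hmle hw
  obtain ⟨hmL, hmb⟩ := le_min_iff.1 hmle
  set S₀ := SmoothInit.sobolevNorm s (u 0) with hS₀
  have hS₀0 : 0 ≤ S₀ := SmoothInit.sobolevNorm_nonneg s (u 0)
  have hN' : (0 : ℝ) < N := by exact_mod_cast hN
  have hM' : (0 : ℝ) < M := by exact_mod_cast hM
  set P := (2 * π * L / N) ^ (k + 1) with hP
  set X := (2 * π / M) ^ s with hX
  have hP0 : 0 ≤ P := by positivity
  have hX0 : 0 ≤ X := by positivity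
  set Y := (P + X) * S₀ + ε with hY
  have hPS : 0 ≤ P * S₀ := by positivity
  have hXS : 0 ≤ X * S₀ := by positivity
  have hYe : Y = P * S₀ + X * S₀ + ε := by rw [hY]; ring
  have hY0 : 0 ≤ Y := by linarith
  have hδ' : SmoothInit.sobolevTail s η (u 0) ≤ ε * η ^ s := by
    have h1 : 0 ≤ SmoothInit.sobolevTail s η (u 0) / ε := div_nonneg (Real.sqrt_nonneg _) hε.le
    have h2 := Real.rpow_le_rpow (Real.rpow_nonneg h1 _) hδ hs0.le
    rw [← Real.rpow_mul h1, one_div_mul_cancel hs0.ne', Real.rpow_one, div_le_iff₀ hε] at h2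
    linarith
  -- The same coefficient is bounded in two ways: by the `H^s` norm of `u_0` against `P`, and by the
  -- `L²` norm of `u_T` against `e^{-πL}`, where the hypothesis on `u_T` applies.
  have hθ : ∀ l, ‖SmoothInit.waveCoeff 1 (u T) l‖ * (P + rexp (-(π * L))) ≤ P * S₀ + K * ε := by
    intro l
    have h1 : ‖SmoothInit.waveCoeff 1 (u T) l‖ ≤ S₀ := by
      rw [hu.norm_waveCoeff_final hT]
      refine (mul_le_of_le_one_left (norm_nonneg _) (Real.exp_le_one_iff.2 ?_)).trans
        (SmoothInit.norm_coeff_le_sobolevNorm hs0.le h0 l)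
      have : 0 ≤ (l : ℝ) ^ 2 * T := by positivity
      linarith
    have h2 : ‖SmoothInit.waveCoeff 1 (u T) l‖ ≤ SmoothInit.l2Norm (u T) := by
      rw [← SmoothInit.norm_coeff_eq]
      exact SmoothInit.norm_coeff_le_l2Norm (hu.continuous ⟨hT.le, le_rfl⟩) l
    have h3 : rexp (-(π * L)) ≤ rexp (-(π * L - 4.5 * η ^ 2 * T)) := by
      apply Real.exp_le_exp.2
      have : 0 ≤ 4.5 * η ^ 2 * T := by positivity
      linarith
    have h4 : rexp (-(π * L)) * ‖SmoothInit.waveCoeff 1 (u T) l‖ ≤ K * ε :=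
      (mul_le_mul h3 h2 (norm_nonneg _) (exp_pos _).le).trans hK'
    have h5 := mul_le_mul_of_nonneg_left h1 hP0
    linarith
  have hβ₁ := hu.sum_norm_sub_le hT hs0.le h0 hM hMe
  have hβ₃ := (SmoothInit.sum_high_le hs h0 M (η := η)).trans
    (mul_le_mul_of_nonneg_left hδ' (by positivity))
  -- The factor `P + e^{-πL}` stays inside the summand, so that the bound just proved applies mode
  -- by mode.
  have hβ₂ := SmoothInit.sum_low_le (η := η)
    (b := fun l => ‖SmoothInit.waveCoeff 1 (u T) l‖ * (P + rexp (-(π * L))))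
    (X := P * S₀ + K * ε) (by positivity) hθ M
  set β₂ := ∑ j, (if |(SmoothInit.nodeFreq M j : ℝ)| ≤ η then
    ‖SmoothInit.waveCoeff 1 (u T) (SmoothInit.nodeFreq M j)‖ else 0) with hβ₂def
  have hβ₂0 : 0 ≤ β₂ := Finset.sum_nonneg fun j _ => by split_ifs <;> positivity
  have hβ₂θ : β₂ * (P + rexp (-(π * L))) ≤ κ₂ * Y := by
    have h1 : β₂ * (P + rexp (-(π * L))) ≤ (1 + η ^ 2) * S * (P * S₀ + K * ε) := by
      refine le_trans (le_of_eq ?_) hβ₂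
      rw [hβ₂def, Finset.sum_mul]
      exact Finset.sum_congr rfl fun j _ => by split_ifs <;> simp
    refine h1.trans ?_
    rw [hκ₂, mul_assoc _ (1 + K)]
    refine mul_le_mul_of_nonneg_left ?_ (by positivity)
    rw [hYe]
    have h2 : 0 ≤ K * (P * S₀) := by positivity
    have h3 : 0 ≤ K * (X * S₀) := by positivity
    linarith
  have hmL' : m ≤ π * L := by
    have : 0 ≤ η ^ 2 * T := by positivity
    linarith
  have hCm : C₁ * (1 + m) ≤ C₁ * (1 + b) := mul_le_mul_of_nonneg_left (by linarith) hC₁.le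
  have hK₁ : ∀ c, ∫ p in (η ^ 2 * T)..(η ^ 2 * T + m),
      ‖SmoothInit.interp L N (SmoothInit.profileNodes k L N) (p - c)‖ ^ 2 ≤ C₁ * (1 + b) :=
    fun c => (hI L N (η ^ 2 * T) c m hL hN hNe hm hmL').1.trans hCm
  have hK₂ : ∀ c, c ≤ η ^ 2 * T → η ^ 2 * T + m - c ≤ π * L →
      ∫ p in (η ^ 2 * T)..(η ^ 2 * T + m),
        ‖SmoothInit.interp L N (SmoothInit.profileNodes k L N) (p - c) -
          SmoothInit.smoothProfile k (p - c)‖ ^ 2 ≤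
        C₁ * (1 + b) * (P + rexp (-(π * L))) ^ 2 := fun c hc hc' =>
    ((hI L N (η ^ 2 * T) c m hL hN hNe hm hmL').2 (sub_nonneg.2 hc) hc').trans
      (mul_le_mul_of_nonneg_right hCm (sq_nonneg _))
  have hQm : rexp (η ^ 2 * T + m) ≤ Q := Real.exp_le_exp.2 (by linarith)
  have hbound := SmoothInit.recovered_error_le k hs0.le hT hL hN hNe hM hMe hu h0 hm hmL hQm hw
    hK₁ hK₂ hβ₁ hβ₂def.ge hβ₃
  have t3 : (1 + S) * (ε * η ^ s) ≤ κ₃ * Y := by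
    rw [hκ₃, mul_comm ε, ← mul_assoc]
    exact mul_le_mul_of_nonneg_left (by linarith) hκ₃0
  have t1 : E * (X * S₀) + (1 + S) * (ε * η ^ s) ≤ κ₁ * Y := by
    have : E * (X * S₀) ≤ E * Y := mul_le_mul_of_nonneg_left (by linarith) hE0
    rw [hκ₁, add_mul]
    linarith
  exact SmoothInit.combine_error_bounds hb0.le hmb (by positivity) hV0
    (add_nonneg hP0 (exp_pos _).le) hXS (by linarith) (mul_nonneg hE0 hXS) hβ₂0 (by positivity)
    t1 hβ₂θ t3 hV hbound
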